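/- Let $r\ge 1$. Let $W$ be the Weyl group of type $B_r$ with Coxeter generators $s_0,s_1,\dots,s_{r-1}$, realised as the group of signed permutations of $r$ letters ($s_0$ changes the sign of the first letter, $s_i$ interchanges the letters $i$ and $i+1$), and put $t_1=s_0$, $t_i=s_{i-1}t_{i-1}s_{i-1}$ for $2\le i\le r$. Let $\mathcal Z_0=\mathbb Z[q,q^{-1},q_0,q_0^{-1}]$, let $$g_r=\prod_{i=-(r-1)}^{r-1}(q_0+q^i)\in\mathcal Z_0,$$ and let $\mathcal Z_{0,g_r}$ be the localization of $\mathcal Z_0$ at $g_r$. For a commutative ring $R$ and elements $q_0,q\in R$, let $\mathcal H$ be the Hecke algebra of $W$ over $R$ with parameters $q_0,q$: it is generated by elements $T_w$ ($w\in W$), with $T_1=1$, $T_xT_y=T_{xy}$ if $\ell(xy)=\ell(x)+\ell(y)$, $T_{s_0}^2=(q_0-1)T_{s_0}+q_0$, and $T_{s_i}^2=(q-1)T_{s_i}+q$ for $1\le i\le r-1$. For a pair $\lambda=(\lambda^{(1)},\lambda^{(2)})$ of compositions (zero parts allowed) of total size $r$, with $a=|\lambda^{(1)}|$, let $$x_\lambda=\pi_a\,\bar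 x_\lambda,\qquad \pi_a=\prod_{i=1}^{a}(q^{i-1}+T_{t_i}),\qquad \bar x_\lambda=\sum_{w\in\mathfrak S_{\bar\lambda}}T_w,$$ where $\mathfrak S_{\bar\lambda}\subseteq\langle s_1,\dots,s_{r-1}\rangle\cong\mathfrak S_r$ is the Young subgroup of the composition $\bar\lambda$ of $r$ obtained by juxtaposing $\lambda^{(1)}$ and $\lambda^{(2)}$. Let $\Pi_2$ be the set of all such $\lambda$ for which both $\lambda^{(1)}$ and $\lambda^{(2)}$ have $r$ parts, and let $\Pi_{1!}\subseteq\Pi_2$ be the subset of those $\lambda$ with $|\lambda^{(1)}|=0$. The $q$-Schur$^2$ algebra and the Geck–Gruber–Hiss algebra are the endomorphism algebras of right $\mathcal H$-modules $$\mathcal S_q^2(r,r;R)=\operatorname{End}_{\mathcal H}\Big(\bigoplus_{\lambda\in\Pi_2}x_\lambda\mathcal H\Big),\qquad \mathcal S_q^{1!}(r,r;R)=\operatorname{End}_{\mathcal H}\Big(\bigoplus_{\lambda\in\Pi_{1!}}x_\lambda\mathcal H\Big).$$ **Theorem.** For every commutative $\mathcal Z_{0,g_r}$-algebra $\mathcal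 Z'$ (with $q_0,q$ the images in $\mathcal Z'$ of the two variables), the $\mathcal Z'$-algebras $\mathcal S_q^2(r,r;\mathcal Z')$ and $\mathcal S_q^{1!}(r,r;\mathcal Z')$ are Morita equivalent, i.e. their module categories are $\mathcal Z'$-linearly equivalent. In particular, this Morita equivalence holds in the linear prime case, that is, whenever $\ell$ is a prime, $Q$ is a prime power not divisible by $\ell$, $m\ge0$ is an integer, $\mathcal Z'$ is a commutative ring in which every integer prime to $\ell$ is invertible (for instance any of the rings $K,\mathcal O,k$ of an $\ell$-modular system), and the parameters in $\mathcal Z'$ are * $(q_0,q)=(Q^m,Q)$, where $Q^i\not\equiv-1\pmod \ell$ for all $i\ge0$ (symplectic and orthogonal groups); or * $(q_0,q)=(Q^{2m+1},Q^2)$, where $Q^{2i+1}\not\equiv-1\pmod \ell$ for all $i\ge0$ (unitary groups). -/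

import Mathlib

open scoped DirectSum

noncomputable section

namespace QSchurB

/-! ## The Weyl group of type `B` -/

/-- The signed letters `ε • (i + 1)`, for `i : Fin r` and a sign `ε`. -/
abbrev SignedLetter (r : ℕ) : Type := Fin r × ℤˣ

/-- The permutation `x ↦ -x` of the signed letters. -/
def negLetter (r : ℕ) : Equiv.Perm (SignedLetter r) :=
  Equiv.prodCongr (Equiv.refl (Fin r)) (Equiv.neg ℤˣ)

/-- The Weyl group `W_r` of type `B_r`, realised as the group of signed permutations, i.e. of
the permutations `w` of the signed letters with `w (-x) = - w x`. -/
abbrev W (r : ℕ) : Type := Subgroup.centralizer ({negLetter r} : Set (Equiv.Perm (SignedLetter r)))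

/-- A permutation of the `r` letters, as a signed permutation not changing any sign. -/
def letterPerm {r : ℕ} (σ : Equiv.Perm (Fin r)) : W r :=
  ⟨Equiv.prodCongr σ (Equiv.refl ℤˣ), by
    rw [Subgroup.mem_centralizer_singleton_iff]
    ext x <;> rfl⟩

/-- The sign change of the `i`-th letter, with letters numbered from `0`
(and the identity if `r ≤ i`).  So `signChange r (i - 1)` is the element `t_i` of `W_r`, where
`t_1 = s_0` and `t_i = s_{i-1} t_{i-1} s_{i-1}`. -/
def signChange (r i : ℕ) : W r :=
  ⟨Function.Involutive.toPerm
      (fun x : SignedLetter r => (x.1, if x.1.val = i then -x.2 else x.2))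
      (fun x => by by_cases h : x.1.val = i <;> simp [h]), by
    rw [Subgroup.mem_centralizer_singleton_iff]
    ext x
    · rfl
    · by_cases h : x.1.val = i <;> simp [negLetter, Function.Involutive.toPerm, h]⟩

/-- The Coxeter generators `s_0, …, s_{r-1}` of `W_r`: `s_0` changes the sign of the first letter,
and `s_i`, for `1 ≤ i < r`, interchanges the `i`-th and `(i+1)`-st letters (numbered from `1`). -/
def simple {r : ℕ} (i : Fin r) : W r :=
  if i.val = 0 then signChange r 0
  else letterPerm (Equiv.swap ⟨i.val - 1, lt_of_le_of_lt (Nat.sub_le _ _) i.isLt⟩ i)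

/-- The length `ℓ(w)` of `w` with respect to `S = {s_0, …, s_{r-1}}`. -/
def length {r : ℕ} (w : W r) : ℕ :=
  sInf {k : ℕ | ∃ l : List (Fin r), l.length = k ∧ (l.map simple).prod = w}

/-! ## The Hecke algebra of type `B` with two parameters -/

section Hecke

variable (r : ℕ) {R : Type*} [CommRing R] (q₀ q : R)

/-- The parameter of the generator `s_i`: it is `q₀` for `s_0` and `q` for the others. -/
def param {r : ℕ} {R : Type*} (q₀ q : R) (i : Fin r) : R := if i.val = 0 then q₀ else q

/-- The defining relations of the Hecke algebra of `W_r` in the generators `T_w`, `w ∈ W_r`. -/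
inductive HeckeRel : FreeAlgebra R (W r) → FreeAlgebra R (W r) → Prop
  /-- `T_1 = 1` -/
  | one : HeckeRel (FreeAlgebra.ι R 1) 1
  /-- `T_x T_y = T_{xy}` if `ℓ(xy) = ℓ(x) + ℓ(y)` -/
  | mul (x y : W r) (h : length (x * y) = length x + length y) :
      HeckeRel (FreeAlgebra.ι R x * FreeAlgebra.ι R y) (FreeAlgebra.ι R (x * y))
  /-- `T_s² = (q_s - 1) T_s + q_s`, where `q_s = q₀` if `s = s_0`, and `q_s = q` otherwise -/
  | quad (i : Fin r) :
      HeckeRel (FreeAlgebra.ι R (simple i) * FreeAlgebra.ι R (simple i))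
        ((param q₀ q i - 1) • FreeAlgebra.ι R (simple i) + algebraMap R _ (param q₀ q i))

/-- The Hecke algebra of type `B_r` over `R` with parameters `q₀` (for `s_0`) and `q`
(for `s_1, …, s_{r-1}`). -/
def Hecke : Type _ := RingQuot (HeckeRel r q₀ q)

instance : Ring (Hecke r q₀ q) := inferInstanceAs (Ring (RingQuot (HeckeRel r q₀ q)))

instance : Algebra R (Hecke r q₀ q) := inferInstanceAs (Algebra R (RingQuot (HeckeRel r q₀ q)))

variable {r}

/-- The basis element `T_w`. -/
def T (w : W r) : Hecke r q₀ q :=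
  RingQuot.mkAlgHom R (HeckeRel r q₀ q) (FreeAlgebra.ι R w)

variable (r) in
/-- `π_a = ∏_{i=1}^{a} (q^{i-1} + T_{t_i})`. -/
def piElt (a : ℕ) : Hecke r q₀ q :=
  ((List.range a).map fun i => algebraMap R (Hecke r q₀ q) (q ^ i) + T q₀ q (signChange r i)).prod

end Hecke

/-! ## Bicompositions -/

/-- The set `Π₂(n, r)` of bicompositions `(λ⁽¹⁾, λ⁽²⁾)` of `r`, where `λ⁽¹⁾` has `max n r` parts and
`λ⁽²⁾` has `n` parts (zero parts are allowed). -/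
abbrev Bicomp (n r : ℕ) : Type :=
  {p : (Fin (max n r) → ℕ) × (Fin n → ℕ) // ∑ i, p.1 i + ∑ i, p.2 i = r}

/-- `|λ⁽¹⁾|` -/
def Bicomp.size₁ {n r : ℕ} (lam : Bicomp n r) : ℕ := ∑ i, lam.1.1 i

/-- The composition of `r` obtained by juxtaposition of `λ⁽¹⁾` and `λ⁽²⁾`. -/
def Bicomp.bar {n r : ℕ} (lam : Bicomp n r) : List ℕ := List.ofFn lam.1.1 ++ List.ofFn lam.1.2

/-- The set of bicompositions in `Π₂(n, r)` with `|λ⁽¹⁾| = 0`. -/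
abbrev BicompOne (n r : ℕ) : Type := {lam : Bicomp n r // lam.size₁ = 0}

/-- The Young subgroup of `⟨s_1, …, s_{r-1}⟩ ≅ 𝔖_r` of a composition of `r`: it is generated by
the `s_i`, `1 ≤ i < r`, such that `i` is not a partial sum of the composition. -/
def young (r : ℕ) (c : List ℕ) : Subgroup (W r) :=
  Subgroup.closure
    {w | ∃ i : Fin r, 0 < i.val ∧ (∀ k : ℕ, i.val ≠ (c.take k).sum) ∧ w = simple i}

/-! ## The `q`-Schur algebras -/

section Schur

variable {n r : ℕ} {R : Type*} [CommRing R] (q₀ q : R)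

open scoped Classical in
/-- The sum of the `T_w`, for `w` in the Young subgroup of the composition belonging to `λ`. -/
def xBar (lam : Bicomp n r) : Hecke r q₀ q :=
  ∑ w : W r with w ∈ young r lam.bar, T q₀ q w

/-- `x_λ = π_a x̄_λ`, with `a = |λ⁽¹⁾|`. -/
def x (lam : Bicomp n r) : Hecke r q₀ q := piElt r q₀ q lam.size₁ * xBar q₀ q lam

/-- The right ideal `x_λ H`; right modules over `H` are modules over `Hᵐᵒᵖ`. -/
def permIdeal (lam : Bicomp n r) : Submodule (Hecke r q₀ q)ᵐᵒᵖ (Hecke r q₀ q) :=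
  Submodule.span (Hecke r q₀ q)ᵐᵒᵖ {x q₀ q lam}

/-- The cyclic right `H`-module `x_λ H`. -/
def PermModule (lam : Bicomp n r) : Type _ := permIdeal q₀ q lam

section

variable (lam : Bicomp n r)

instance : AddCommGroup (PermModule q₀ q lam) :=
  inferInstanceAs (AddCommGroup (permIdeal q₀ q lam))

instance : Module (Hecke r q₀ q)ᵐᵒᵖ (PermModule q₀ q lam) :=
  inferInstanceAs (Module (Hecke r q₀ q)ᵐᵒᵖ (permIdeal q₀ q lam))

instance : Module R (PermModule q₀ q lam) :=
  inferInstanceAs (Module R (permIdeal q₀ q lam))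

instance : SMulCommClass (Hecke r q₀ q)ᵐᵒᵖ R (PermModule q₀ q lam) :=
  inferInstanceAs (SMulCommClass (Hecke r q₀ q)ᵐᵒᵖ R (permIdeal q₀ q lam))

instance : IsScalarTower R (Hecke r q₀ q)ᵐᵒᵖ (PermModule q₀ q lam) :=
  inferInstanceAs (IsScalarTower R (Hecke r q₀ q)ᵐᵒᵖ (permIdeal q₀ q lam))

end

variable (n r)

/-- The `q`-Schur² algebra: the endomorphism algebra of the right `H`-module `⨁ x_λ H`, where `λ`
runs over all bicompositions in `Π₂(n, r)`. -/
abbrev qSchurTwo : Type _ :=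
  Module.End (Hecke r q₀ q)ᵐᵒᵖ (⨁ lam : Bicomp n r, PermModule q₀ q lam)

/-- The `q`-Schur algebra of Geck–Gruber–Hiss: the endomorphism algebra of the right `H`-module
`⨁ x_λ H`, where `λ` runs over the bicompositions in `Π₂(n, r)` with `|λ⁽¹⁾| = 0`. -/
abbrev qSchurOne : Type _ :=
  Module.End (Hecke r q₀ q)ᵐᵒᵖ (⨁ lam : BicompOne n r, PermModule q₀ q lam.1)

end Schur

/-! ## The generic base rings -/

/-- The ring `ℤ[q, q⁻¹, q₀, q₀⁻¹]`, as Laurent polynomials in `q₀` over `ℤ[q, q⁻¹]`. -/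
abbrev Z₀ : Type := LaurentPolynomial (LaurentPolynomial ℤ)

/-- The variable `q₀`. -/
def Z₀.q₀ : Z₀ := LaurentPolynomial.T 1

/-- `q ^ i`, for the variable `q` and an integer `i`. -/
def Z₀.qPow (i : ℤ) : Z₀ := LaurentPolynomial.C (LaurentPolynomial.T i)

/-- `g_r = ∏_{i=-(r-1)}^{r-1} (q₀ + q^i)`. -/
def g (r : ℕ) : Z₀ :=
  ∏ i ∈ Finset.Icc (-((r : ℤ) - 1)) ((r : ℤ) - 1), (Z₀.q₀ + Z₀.qPow i)

/-- The localization of `ℤ[q, q⁻¹, q₀, q₀⁻¹]` at `g_r`. -/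
abbrev Z₀g (r : ℕ) : Type := Localization.Away (g r)

section Specialization

variable (r : ℕ) (R : Type*) [CommRing R] [Algebra (Z₀g r) R]

/-- The image of `q₀` in an algebra over the localization at `g_r`. -/
def q₀In : R := algebraMap (Z₀g r) R (algebraMap Z₀ (Z₀g r) Z₀.q₀)

/-- The image of `q` in an algebra over the localization at `g_r`. -/
def qIn : R := algebraMap (Z₀g r) R (algebraMap Z₀ (Z₀g r) (Z₀.qPow 1))

end Specialization

/-! ## The linear prime case -/

/-- `ℓ` is a linear prime for a series of finite classical groups over a field related to the
prime power `Q`, and `(a, b)` are the parameters `(q₀, q)` of a Hecke algebra of type `B` belonging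
to this series.

For symplectic and orthogonal groups over the field with `Q` elements, the parameters are
`(Q ^ m, Q)` (with `m = 0, 1, 2` for the split even orthogonal, the symplectic and odd orthogonal,
and the non-split even orthogonal groups when the Hecke algebra is that of a Borel subgroup), and
`ℓ ∤ Q` is linear if no `Q ^ i`, `i ≥ 0`, is congruent to `-1` modulo `ℓ`.

For unitary groups over the field with `Q ^ 2` elements, the parameters are `(Q ^ (2m+1), Q ^ 2)`
(with `m = 0, 1` for the Hecke algebra of a Borel subgroup of the even- and odd-dimensional groups),
and `ℓ ∤ Q` is linear if no odd power of `Q` is congruent to `-1` modulo `ℓ`. -/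
inductive IsLinearPrimeCase (ℓ : ℕ) : ℕ → ℕ → Prop
  | symplecticOrthogonal (Q m : ℕ) (hQ : IsPrimePow Q) (hℓ : ℓ.Prime) (hℓQ : ¬ ℓ ∣ Q)
      (hlin : ∀ i : ℕ, ¬ ℓ ∣ Q ^ i + 1) : IsLinearPrimeCase ℓ (Q ^ m) Q
  | unitary (Q m : ℕ) (hQ : IsPrimePow Q) (hℓ : ℓ.Prime) (hℓQ : ¬ ℓ ∣ Q)
      (hlin : ∀ i : ℕ, ¬ ℓ ∣ Q ^ (2 * i + 1) + 1) : IsLinearPrimeCase ℓ (Q ^ (2 * m + 1)) (Q ^ 2)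

end QSchurB

end

/-! The point is that each `x_λ H` is a direct summand of some `x_μ H` with `|μ⁽¹⁾| = 0`. The sum
over all `λ` contains the sum over those `μ` as a summand, and is itself a summand of a finite power
of the latter; endomorphism algebras of two such modules are Morita equivalent through a full
idempotent (`isMoritaEquivalent_end_of_retract`).

For the summand property, let `L_i = T_{t_{i+1}}`, a product `S_i ⋯ S_1 S_0 S_1 ⋯ S_i` of
generators, and let `M_i = S_i ⋯ S_1 S_1 ⋯ S_i`. The element `π_a` commutes with `S_1, …, S_{a-1}`
and absorbs `S_0` as the scalar `q₀` if `a > 0`, so `π_a L_i = q₀ π_a M_i` for `i < a`. Hence `π_a²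
= z π_a`, where `z = ∏_{i<a} (q^i + q₀ M_i)` commutes with `π_a` (`piProd_mul_self`). Each `M_i` is
a root of a monic polynomial whose roots are powers `q^k` with `0 ≤ k ≤ 2i` (`exists_rootProd`), so
`z` is a unit as soon as all `q^i + q₀ q^k` are. Up to a power of `q` these are factors of `g_r`; in
the linear prime case they are integers prime to `ℓ`.

Since `π_a` also commutes with `x̄_λ` (`commute_piElt_xBar`), `x_λ H` lies in `x̄_λ H`, and left
multiplication by `π_a` maps `x̄_λ H` onto `x_λ H` and restricts to an automorphism of `x_λ H`; this
gives the splitting (`exists_retraction_span_mul`). Finally `x̄_λ = x_μ`, where `μ⁽²⁾` consists of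
the nonzero parts of `λ`, padded by zeros.

The combinatorics of signed permutations serves to compute lengths, so that the relations `T_x T_y =
T_{xy}` yield the braid relations and the product formula for `T_{t_i}`. -/

/-! ## Morita equivalence from a full idempotent -/

open CategoryTheory

section FullCorner

universe u₀ u

/-- A presentation of the `R`-algebra `B` as the corner `e A e` of `A` for an idempotent `e = j 1`
which is full, i.e. `1 ∈ A e A`. -/
structure FullCorner (R : Type u₀) [CommRing R] (A : Type u) [Ring A] [Algebra R A]
    (B : Type u) [Ring B] [Algebra R B] where
  /-- the inclusion of the corner -/
  j : B →ₗ[R] A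
  /-- the compression to the corner -/
  k : A →ₗ[R] B
  j_mul : ∀ x y, j (x * y) = j x * j y
  k_j : ∀ x, k (j x) = x
  j_k : ∀ c, j (k c) = j 1 * c * j 1
  /-- the index set of a decomposition of `1` in `A e A` -/
  I : Type
  [fin : Fintype I]
  /-- the left factors -/
  a : I → A
  /-- the right factors -/
  b : I → A
  sum_eq : ∑ i, a i * j 1 * b i = 1

namespace FullCorner

attribute [instance] FullCorner.fin

variable {R : Type u₀} [CommRing R] {A : Type u} [Ring A] [Algebra R A]
  {B : Type u} [Ring B] [Algebra R B] (C : FullCorner R A B)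

lemma j_injective : Function.Injective C.j := Function.LeftInverse.injective C.k_j

lemma j_one_mul (x : B) : C.j 1 * C.j x = C.j x := by rw [← C.j_mul, one_mul]

/-- Compression to `e A e` is multiplicative only across an inserted `e`. Such an `e` is supplied by
`1 = ∑ a_i e b_i`. -/
lemma k_mul (x y : A) : C.k (x * C.j 1 * y) = C.k x * C.k y := by
  apply C.j_injective
  rw [C.j_mul, C.j_k, C.j_k, C.j_k]
  have h : C.j 1 * C.j 1 = C.j 1 := C.j_one_mul 1
  calc C.j 1 * (x * C.j 1 * y) * C.j 1 = C.j 1 * x * C.j 1 * y * C.j 1 := by noncomm_ring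
    _ = C.j 1 * x * (C.j 1 * C.j 1) * y * C.j 1 := by rw [h]
    _ = _ := by noncomm_ring

lemma k_one : C.k 1 = 1 := by
  apply C.j_injective
  rw [C.j_k, mul_one, C.j_one_mul]

section Restrict

variable (X : Type u) [AddCommGroup X] [Module A X]

/-- The subgroup `e X` of an `A`-module `X`. -/
def fixed : AddSubgroup X where
  carrier := {x | C.j 1 • x = x}
  zero_mem' := smul_zero _
  add_mem' {_ _} hx hy := by
    change C.j 1 • (_ + _) = _ + _
    rw [smul_add, hx, hy]
  neg_mem' {x} hx := by
    change C.j 1 • (-x) = -x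
    rw [smul_neg, hx]

variable {X}

lemma mem_fixed {x : X} : x ∈ C.fixed X ↔ C.j 1 • x = x := Iff.rfl

lemma smul_mem_fixed (c : B) (x : X) : C.j c • x ∈ C.fixed X := by
  rw [mem_fixed, smul_smul, C.j_one_mul]

instance : Module B (C.fixed X) where
  smul c x := ⟨C.j c • x.1, C.smul_mem_fixed c x.1⟩
  one_smul x := Subtype.ext x.2
  mul_smul c d x := Subtype.ext <| by
    change C.j (c * d) • x.1 = C.j c • C.j d • x.1
    rw [C.j_mul, mul_smul]
  smul_zero c := Subtype.ext (smul_zero _)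
  smul_add c x y := Subtype.ext (smul_add _ _ _)
  add_smul c d x := Subtype.ext <| by
    change C.j (c + d) • x.1 = C.j c • x.1 + C.j d • x.1
    rw [map_add, add_smul]
  zero_smul x := Subtype.ext <| by
    change C.j 0 • x.1 = 0
    rw [map_zero, zero_smul]

lemma coe_smul (c : B) (x : C.fixed X) : ((c • x : C.fixed X) : X) = C.j c • (x : X) := rfl

lemma j_k_smul (c : A) (x : C.fixed X) : C.j (C.k c) • (x : X) = C.j 1 • c • (x : X) := by
  rw [C.j_k, mul_smul, mul_smul, C.mem_fixed.1 x.2]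

variable {Y : Type u} [AddCommGroup Y] [Module A Y]

/-- The restriction of an `A`-linear map to the corners. -/
def mapFixed (f : X →ₗ[A] Y) : C.fixed X →ₗ[B] C.fixed Y where
  toFun x := ⟨f x.1, by rw [mem_fixed, ← map_smul, C.mem_fixed.1 x.2]⟩
  map_add' x y := Subtype.ext (map_add f _ _)
  map_smul' c x := Subtype.ext (map_smul f _ _)

lemma sum_smul (x : X) : ∑ i, C.a i • C.j 1 • C.b i • x = x := by
  conv_rhs => rw [← one_smul A x, ← C.sum_eq, Finset.sum_smul]
  simp [mul_smul]

lemma coe_map_fixed (g : C.fixed X →ₗ[B] C.fixed Y) (c : B) (x : C.fixed X) :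
    (g (c • x) : Y) = C.j c • (g x : Y) := by rw [map_smul]; rfl

/-- The element `e x` of `e X`. -/
def cut (x : X) : C.fixed X := ⟨C.j 1 • x, C.smul_mem_fixed 1 x⟩

lemma cut_add (x y : X) : C.cut (x + y) = C.cut x + C.cut y := Subtype.ext (smul_add _ _ _)

lemma cut_sum {ι : Type} (s : Finset ι) (x : ι → X) :
    C.cut (∑ i ∈ s, x i) = ∑ i ∈ s, C.cut (x i) :=
  map_sum (AddMonoidHom.mk' C.cut C.cut_add) x s

lemma cut_smul_smul (c d : A) (x : X) :
    C.cut (c • C.j 1 • d • x) = C.k c • C.cut (d • x) := by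
  apply Subtype.ext
  rw [coe_smul, j_k_smul]
  rfl

/-- The extension of a linear map between corners. -/
def extendFixed (g : C.fixed X →ₗ[B] C.fixed Y) : X →ₗ[A] Y where
  toFun x := ∑ i, C.a i • (g (C.cut (C.b i • x)) : Y)
  map_add' x y := by simp [cut_add, Finset.sum_add_distrib]
  map_smul' c x := by
    -- Inserting `1 = ∑ a_l e b_l` between `c` and `x` turns the action of `c` into the matrix of
    -- the `e b_i c a_l e`, whose entries lie in the corner and pass through `g`.
    have h : ∀ i, C.cut (C.b i • c • x) =
        ∑ l, C.k (C.b i * c * C.a l) • C.cut (C.b l • x) := by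
      intro i
      conv_lhs => rw [← C.sum_smul x, Finset.smul_sum, Finset.smul_sum, cut_sum]
      refine Finset.sum_congr rfl fun l _ => ?_
      rw [← cut_smul_smul, mul_smul, mul_smul]
    simp only [h, map_sum, AddSubgroup.val_finsetSum, coe_map_fixed, j_k_smul,
      Finset.smul_sum, RingHom.id_apply]
    rw [Finset.sum_comm]
    refine Finset.sum_congr rfl fun l _ => ?_
    simp only [mul_smul]
    exact C.sum_smul (c • C.a l • (g (C.cut (C.b l • x)) : Y))

lemma mapFixed_extendFixed (g : C.fixed X →ₗ[B] C.fixed Y) :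
    C.mapFixed (C.extendFixed g) = g := by
  ext x
  change ∑ i, C.a i • (g (C.cut (C.b i • (x : X))) : Y) = g x
  have h : ∀ i, C.cut (C.b i • (x : X)) = C.k (C.b i) • x := fun i =>
    Subtype.ext (by rw [coe_smul, j_k_smul]; rfl)
  simp only [h, coe_map_fixed, j_k_smul]
  exact C.sum_smul _

/-- Since `x = ∑ a_i (e b_i x)`, the subgroup `e X` generates `X` over `A`. -/
lemma mapFixed_injective : Function.Injective (C.mapFixed : (X →ₗ[A] Y) → _) := by
  intro f g h
  ext x
  rw [← C.sum_smul x]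
  simp only [map_sum, map_smul]
  refine Finset.sum_congr rfl fun i _ => ?_
  have := congrArg Subtype.val (LinearMap.congr_fun h (C.cut (C.b i • x)))
  change f (C.j 1 • C.b i • x) = g (C.j 1 • C.b i • x) at this
  rw [map_smul, map_smul, map_smul, map_smul] at this
  rw [this]

end Restrict

section Induce

variable (Y : Type u) [AddCommGroup Y] [Module B Y]

/-- The action of `c : A` on `Y ^ I` by the matrix of the `e b_i c a_l e`. -/
def act (c : A) (y : C.I → Y) : C.I → Y := fun i => ∑ l, C.k (C.b i * c * C.a l) • y l

variable {Y}

/-- Insert `1 = ∑ a_m e b_m` between `c` and `d`. In particular `1` acts by an idempotent matrix,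
whose image is a concrete model of `A e ⊗ Y` over the corner. -/
lemma act_mul (c d : A) (y : C.I → Y) : C.act Y (c * d) y = C.act Y c (C.act Y d y) := by
  funext i
  simp only [act, Finset.smul_sum, smul_smul, ← k_mul]
  rw [Finset.sum_comm]
  refine Finset.sum_congr rfl fun l _ => ?_
  rw [← Finset.sum_smul, ← map_sum]
  congr 2
  calc C.b i * (c * d) * C.a l = C.b i * c * 1 * d * C.a l := by noncomm_ring
    _ = C.b i * c * (∑ m, C.a m * C.j 1 * C.b m) * d * C.a l := by rw [C.sum_eq]
    _ = _ := by
      simp only [Finset.mul_sum, Finset.sum_mul, mul_assoc]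

lemma act_add (c : A) (x y : C.I → Y) : C.act Y c (x + y) = C.act Y c x + C.act Y c y := by
  funext i
  simp [act, Finset.sum_add_distrib]

lemma add_act (c d : A) (y : C.I → Y) : C.act Y (c + d) y = C.act Y c y + C.act Y d y := by
  funext i
  simp [act, Finset.sum_add_distrib, mul_add, add_mul, add_smul]

lemma act_zero (c : A) : C.act Y c 0 = 0 := by
  funext i
  simp [act]

lemma zero_act (y : C.I → Y) : C.act Y 0 y = 0 := by
  funext i
  simp [act]

variable (Y) in
/-- The `A`-module induced from a module over the corner `B`. -/
def induced : AddSubgroup (C.I → Y) where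
  carrier := {y | C.act Y 1 y = y}
  zero_mem' := C.act_zero 1
  add_mem' {_ _} hx hy := by
    change C.act Y 1 (_ + _) = _ + _
    rw [act_add, hx, hy]
  neg_mem' {x} hx := by
    change C.act Y 1 (-x) = -x
    rw [eq_neg_iff_add_eq_zero]
    nth_rewrite 2 [← show C.act Y 1 x = x from hx]
    rw [← act_add, neg_add_cancel, act_zero]

lemma act_mem_induced (c : A) (y : C.I → Y) : C.act Y c y ∈ C.induced Y := by
  change C.act Y 1 _ = _
  rw [← act_mul, one_mul]

instance : Module A (C.induced Y) where
  smul c y := ⟨C.act Y c y.1, C.act_mem_induced c y.1⟩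
  one_smul y := Subtype.ext y.2
  mul_smul c d y := Subtype.ext (C.act_mul c d y.1)
  smul_zero c := Subtype.ext (C.act_zero c)
  smul_add c _ _ := Subtype.ext (C.act_add c _ _)
  add_smul c d _ := Subtype.ext (C.add_act c d _)
  zero_smul _ := Subtype.ext (C.zero_act _)

lemma act_k (c : A) (y : Y) :
    C.act Y c (fun i => C.k (C.b i) • y) = fun i => C.k (C.b i * c) • y := by
  funext i
  simp only [act, smul_smul, ← k_mul]
  rw [← Finset.sum_smul, ← map_sum]
  congr 2
  calc _ = C.b i * c * ∑ m, C.a m * C.j 1 * C.b m := by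
        simp only [Finset.mul_sum, mul_assoc]
    _ = _ := by rw [C.sum_eq, mul_one]

lemma k_mul_j (c : A) (d : B) : C.k (c * C.j d) = C.k c * d := by
  rw [← C.j_one_mul, ← mul_assoc, k_mul, k_j]

/-- The corner of an induced module is the module it is induced from. -/
def fixedInduced : Y ≃ₗ[B] C.fixed (C.induced Y) where
  toFun y := ⟨⟨fun i => C.k (C.b i) • y, by
      change C.act Y 1 _ = _
      rw [act_k]; simp⟩, by
      apply Subtype.ext
      change C.act Y (C.j 1) _ = _
      rw [act_k]
      funext i
      rw [k_mul_j, mul_one]⟩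
  map_add' _ _ := by
    apply Subtype.ext; apply Subtype.ext
    funext i
    exact smul_add _ _ _
  map_smul' c y := by
    apply Subtype.ext; apply Subtype.ext
    refine Eq.trans ?_ (C.act_k (C.j c) y).symm
    funext i
    simp only [k_mul_j, mul_smul]
  -- The row of the `e a_l e` is a left inverse of the column of the `e b_l e`, because `∑ a_l e b_l
  -- = 1`; in the other order they give the matrix of `e`, which fixes `x`.
  invFun x := ∑ l, C.k (C.a l) • x.1.1 l
  left_inv y := by
    simp only [smul_smul, ← k_mul]
    rw [← Finset.sum_smul, ← map_sum, C.sum_eq, k_one, one_smul]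
  right_inv x := by
    apply Subtype.ext; apply Subtype.ext
    have h : C.act Y (C.j 1) x.1.1 = x.1.1 := congrArg Subtype.val x.2
    conv_rhs => rw [← h]
    funext i
    simp only [act, Finset.smul_sum, smul_smul, ← k_mul]

end Induce

/-- The functor `X ↦ e X` from `A`-modules to modules over the corner. -/
def functor : ModuleCat.{u} A ⥤ ModuleCat.{u} B where
  obj X := ModuleCat.of B (C.fixed X)
  map f := ModuleCat.ofHom (C.mapFixed f.hom)
  map_id _ := rfl
  map_comp _ _ := rfl

instance : C.functor.Faithful where
  map_injective {X Y f g} h := by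
    apply ModuleCat.hom_ext
    apply C.mapFixed_injective
    exact congrArg ModuleCat.Hom.hom h

instance : C.functor.Full where
  map_surjective g :=
    ⟨ModuleCat.ofHom (C.extendFixed g.hom), ModuleCat.hom_ext (C.mapFixed_extendFixed g.hom)⟩

instance : C.functor.EssSurj where
  mem_essImage Y := ⟨ModuleCat.of A (C.induced Y), ⟨(C.fixedInduced (Y := Y)).symm.toModuleIso⟩⟩

instance : C.functor.IsEquivalence where

open scoped ModuleCat.Algebra

instance : C.functor.Additive where
  map_add := rfl

instance : C.functor.Linear R where
  map_smul {X Y} f r := by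
    ext x
    apply Subtype.ext
    change algebraMap R A r • f.hom x.1 = C.j (algebraMap R B r) • f.hom x.1
    rw [Algebra.algebraMap_eq_smul_one, Algebra.algebraMap_eq_smul_one, map_smul, smul_assoc,
      smul_assoc, one_smul, ← map_smul f.hom (C.j 1), C.mem_fixed.1 x.2]

lemma isMoritaEquivalent (D : FullCorner R A B) : IsMoritaEquivalent R A B :=
  ⟨⟨{ eqv := D.functor.asEquivalence
      linear := inferInstanceAs (D.functor.Linear R) }⟩⟩

end FullCorner

end FullCorner

/-! ## Endomorphism algebras of modules that are summands of sums of each other -/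

section EndMorita

variable {R : Type*} [CommRing R] {Γ : Type*} [Ring Γ] [Algebra R Γ]

/-- If `N` is a direct summand of `M` and `M` is a direct summand of a finite direct sum of copies
of `N`, then the endomorphism algebras are Morita equivalent. -/
theorem isMoritaEquivalent_end_of_retract {M N : Type u}
    [AddCommGroup M] [Module Γ M] [Module R M] [SMulCommClass Γ R M] [IsScalarTower R Γ M]
    [AddCommGroup N] [Module Γ N] [Module R N] [SMulCommClass Γ R N] [IsScalarTower R Γ N]
    (inc : N →ₗ[Γ] M) (pr : M →ₗ[Γ] N) (hpi : pr ∘ₗ inc = LinearMap.id)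
    {I : Type} [Fintype I] (α : I → N →ₗ[Γ] M) (β : I → M →ₗ[Γ] N)
    (h : ∑ i, α i ∘ₗ β i = LinearMap.id) :
    IsMoritaEquivalent R (Module.End Γ M) (Module.End Γ N) := by
  have hpi' : ∀ y, pr (inc y) = y := fun y => LinearMap.congr_fun hpi y
  exact FullCorner.isMoritaEquivalent
    { j :=
        { toFun := fun f => inc ∘ₗ f ∘ₗ pr
          map_add' := fun _ _ => by ext; simp
          map_smul' := fun r f => by ext; simp [LinearMap.map_smul_of_tower inc r] }
      k :=
        { toFun := fun f => pr ∘ₗ f ∘ₗ inc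
          map_add' := fun _ _ => by ext; simp
          map_smul' := fun r f => by ext; simp [LinearMap.map_smul_of_tower pr r] }
      j_mul := fun _ _ => by ext; simp [hpi']
      k_j := fun _ => by ext; simp [hpi']
      j_k := fun _ => by ext; simp
      I := I
      -- Here `e = inc ∘ pr`, so `a_i e b_i` collapses to `α_i ∘ β_i` by `pr ∘ inc = id`.
      a := fun i => α i ∘ₗ pr
      b := fun i => inc ∘ₗ β i
      sum_eq := by
        change _ = LinearMap.id
        rw [← h]
        refine Finset.sum_congr rfl fun i _ => ?_
        ext; simp [hpi'] }

end EndMorita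

noncomputable section

namespace QSchurB

/-! ## Counting inversions of sequences of integers -/

section Inversions

variable {r : ℕ}

/-- The inversions of the sequence `v`, together with the pairs with a negative sum. -/
def invSet (v : Fin r → ℤ) : Finset (Fin r × Fin r × ℤˣ) :=
  {p | p.1 < p.2.1 ∧ v p.2.1 < p.2.2 * v p.1}

/-- The number of inversions, of pairs with a negative sum, and of negative entries. -/
def invCount (v : Fin r → ℤ) : ℕ := (invSet v).card + Finset.card {j | v j < 0}

lemma mem_invSet {v : Fin r → ℤ} {p} :
    p ∈ invSet v ↔ p.1 < p.2.1 ∧ v p.2.1 < p.2.2 * v p.1 := by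
  simp [invSet]

/-- The letter before `i`. -/
abbrev prev (i : Fin r) : Fin r := ⟨i.val - 1, lt_of_le_of_lt (Nat.sub_le _ _) i.isLt⟩

lemma swap_prev_lt {i a b : Fin r} (hi : 0 < i.val) (hab : a < b) (h : ¬ (a = prev i ∧ b = i)) :
    Equiv.swap (prev i) i a < Equiv.swap (prev i) i b := by
  rw [Fin.lt_def] at hab ⊢
  rw [Fin.ext_iff, Fin.ext_iff] at h
  simp only [Equiv.swap_apply_def, Fin.ext_iff, apply_ite Fin.val]
  simp only at h
  split_ifs <;> omega

lemma eq_of_swap_eq_prev {i a : Fin r} (h : Equiv.swap (prev i) i a = prev i) : a = i := by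
  rw [Equiv.swap_apply_eq_iff, Equiv.swap_apply_left] at h
  exact h

lemma eq_prev_of_swap_eq {i a : Fin r} (h : Equiv.swap (prev i) i a = i) : a = prev i := by
  rw [Equiv.swap_apply_eq_iff, Equiv.swap_apply_right] at h
  exact h

/-- Exchanging adjacent positions permutes the other pairs of positions and keeps their order. For
the exchanged pair itself, the condition with sign `-1` is symmetric in the two values. One
inequality suffices, as it can be applied again to the swapped sequence. -/
lemma card_erase_invSet_le (v : Fin r → ℤ) {i : Fin r} (hi : 0 < i.val) :
    ((invSet (v ∘ Equiv.swap (prev i) i)).erase (prev i, i, 1)).card ≤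
      ((invSet v).erase (prev i, i, 1)).card := by
  set s := Equiv.swap (prev i) i with hs
  refine Finset.card_le_card_of_injOn
    (fun p => if p.1 = prev i ∧ p.2.1 = i then p else (s p.1, s p.2.1, p.2.2)) ?_ ?_
  · rintro ⟨a, b, ε⟩ hp
    simp only [Finset.coe_erase, Set.mem_sdiff, Finset.mem_coe, mem_invSet, Function.comp_apply,
      Set.mem_singleton_iff] at hp ⊢
    obtain ⟨⟨hab, hv⟩, hp⟩ := hp
    by_cases h : a = prev i ∧ b = i
    · obtain ⟨rfl, rfl⟩ := h
      rw [if_pos ⟨rfl, rfl⟩]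
      refine ⟨⟨hab, ?_⟩, hp⟩
      rcases Int.units_eq_one_or ε with rfl | rfl
      · exact absurd rfl hp
      · simp only [hs, Equiv.swap_apply_left, Equiv.swap_apply_right, Units.val_neg,
          Units.val_one] at hv ⊢
        linarith
    · rw [if_neg h]
      refine ⟨⟨swap_prev_lt hi hab h, hv⟩, ?_⟩
      intro h'
      simp only [Prod.mk.injEq] at h'
      have h1 : a = i := eq_of_swap_eq_prev h'.1
      have h2 : b = prev i := eq_prev_of_swap_eq h'.2.1
      rw [h1, h2, Fin.lt_def] at hab
      simp only at hab
      omega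
  · rintro ⟨a, b, ε⟩ hp ⟨a', b', ε'⟩ hp' h
    simp only [Finset.coe_erase, Set.mem_sdiff, Finset.mem_coe, mem_invSet] at hp hp'
    by_cases h1 : a = prev i ∧ b = i <;> by_cases h2 : a' = prev i ∧ b' = i
    · simpa [h1, h2] using h
    · simp only [h1, h2, and_self, if_true, if_false, Prod.mk.injEq] at h
      have h3 : a' = i := eq_of_swap_eq_prev h.1.symm
      have h4 : b' = prev i := eq_prev_of_swap_eq h.2.1.symm
      have h5 := hp'.1.1
      simp only [h3, h4, Fin.lt_def] at h5
      omega
    · simp only [h1, h2, and_self, if_true, if_false, Prod.mk.injEq] at h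
      have h3 : a = i := eq_of_swap_eq_prev h.1
      have h4 : b = prev i := eq_prev_of_swap_eq h.2.1
      have h5 := hp.1.1
      simp only [h3, h4, Fin.lt_def] at h5
      omega
    · simpa [h1, h2] using h

lemma invCount_swap (v : Fin r → ℤ) {i : Fin r} (hi : 0 < i.val) (h : v (prev i) < v i) :
    invCount (v ∘ Equiv.swap (prev i) i) = invCount v + 1 := by
  have hneg : Finset.card {j | (v ∘ Equiv.swap (prev i) i) j < 0} = Finset.card {j | v j < 0} := by
    refine Finset.card_equiv (Equiv.swap (prev i) i) fun j => by simp
  have h1 := card_erase_invSet_le v hi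
  have h2 := card_erase_invSet_le (v ∘ Equiv.swap (prev i) i) hi
  have h3 : (v ∘ Equiv.swap (prev i) i) ∘ Equiv.swap (prev i) i = v := by
    funext j
    simp
  rw [h3] at h2
  have hlt : prev i < i := by
    rw [Fin.lt_def]
    simp only
    omega
  have h4 : (prev i, i, (1 : ℤˣ)) ∉ invSet v := by
    simp only [mem_invSet, Units.val_one, one_mul, not_and, not_lt]
    exact fun _ => h.le
  have h5 : (prev i, i, (1 : ℤˣ)) ∈ invSet (v ∘ Equiv.swap (prev i) i) := by
    simp only [mem_invSet, Units.val_one, one_mul, Function.comp_apply, Equiv.swap_apply_left,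
      Equiv.swap_apply_right]
    exact ⟨hlt, h⟩
  rw [Finset.erase_eq_of_notMem h4] at h1 h2
  have h6 := Finset.card_erase_add_one h5
  unfold invCount
  omega

/-- The first position occurs only as the left member of a pair, so negating its entry just flips
the sign labels of these pairs. Only the count of negative entries changes. -/
lemma invCount_neg (v v' : Fin r → ℤ) {i : Fin r} (hi : i.val = 0) (h : 0 < v i)
    (h0 : v' i = -v i) (h' : ∀ j, j ≠ i → v' j = v j) : invCount v' = invCount v + 1 := by
  have h1 : (invSet v').card = (invSet v).card := by
    refine Finset.card_bij' (fun p _ => (p.1, p.2.1, if p.1 = i then -p.2.2 else p.2.2))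
      (fun p _ => (p.1, p.2.1, if p.1 = i then -p.2.2 else p.2.2)) ?_ ?_ ?_ ?_
    · rintro ⟨a, b, ε⟩ hp
      rw [mem_invSet] at hp ⊢
      simp only at hp ⊢
      have hb : b ≠ i := by
        rintro rfl
        have := hp.1
        rw [Fin.lt_def] at this
        omega
      refine ⟨hp.1, ?_⟩
      rw [← h' b hb]
      by_cases ha : a = i
      · subst ha
        rw [h0] at hp
        simpa using hp.2
      · rw [← h' a ha]
        simpa [ha] using hp.2
    · rintro ⟨a, b, ε⟩ hp
      rw [mem_invSet] at hp ⊢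
      simp only at hp ⊢
      have hb : b ≠ i := by
        rintro rfl
        have := hp.1
        rw [Fin.lt_def] at this
        omega
      refine ⟨hp.1, ?_⟩
      rw [h' b hb]
      by_cases ha : a = i
      · subst ha
        rw [h0]
        simpa using hp.2
      · rw [h' a ha]
        simpa [ha] using hp.2
    · rintro ⟨a, b, ε⟩ _
      by_cases ha : a = i <;> simp [ha]
    · rintro ⟨a, b, ε⟩ _
      by_cases ha : a = i <;> simp [ha]
  have h2 : (Finset.univ.filter fun j => v' j < 0) =
      insert i (Finset.univ.filter fun j => v j < 0) := by
    ext j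
    by_cases hj : j = i
    · subst hj
      simp [h0, h]
    · simp [hj, h' j hj]
  unfold invCount
  rw [h1, h2, Finset.card_insert_of_notMem (by simp [h.le])]
  omega

end Inversions

/-! ## The length function of `W_r` -/

section Length

variable {r : ℕ}

/-- The integer represented by a signed letter. -/
def letterVal (p : SignedLetter r) : ℤ := p.2 * ((p.1.val : ℤ) + 1)

/-- The window notation of a signed permutation. -/
def window (w : W r) (j : Fin r) : ℤ := letterVal (w.1 (j, 1))

lemma apply_neg (w : W r) (j : Fin r) (ε : ℤˣ) :
    w.1 (j, -ε) = ((w.1 (j, ε)).1, -(w.1 (j, ε)).2) := by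
  have h := Subgroup.mem_centralizer_singleton_iff.1 w.2
  have := congrArg (fun f : Equiv.Perm (SignedLetter r) => f (j, ε)) h
  exact this

lemma letterVal_neg (p : SignedLetter r) : letterVal (p.1, -p.2) = -letterVal p := by
  simp [letterVal]

lemma letterVal_injective : Function.Injective (letterVal (r := r)) := by
  rintro ⟨a, ε⟩ ⟨b, δ⟩ h
  simp only [letterVal] at h
  rcases Int.units_eq_one_or ε with rfl | rfl <;> rcases Int.units_eq_one_or δ with rfl | rfl <;>
    simp only [Units.val_one, Units.val_neg, one_mul, neg_mul, neg_inj] at h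
  · rw [Prod.mk.injEq, Fin.ext_iff]
    exact ⟨by omega, rfl⟩
  · omega
  · omega
  · rw [Prod.mk.injEq, Fin.ext_iff]
    exact ⟨by omega, rfl⟩

lemma letterVal_ne_zero (p : SignedLetter r) : letterVal p ≠ 0 := by
  rcases p with ⟨a, ε⟩
  rcases Int.units_eq_one_or ε with rfl | rfl <;> simp [letterVal] <;> omega

lemma window_ne_zero (w : W r) (j : Fin r) : window w j ≠ 0 := letterVal_ne_zero _

lemma window_injective (w : W r) : Function.Injective (window w) := by
  intro j k h
  have := w.1.injective (letterVal_injective h)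
  exact (Prod.mk.injEq _ _ _ _ ▸ this).1

lemma letterPerm_apply (σ : Equiv.Perm (Fin r)) (j : Fin r) (ε : ℤˣ) :
    (letterPerm σ).1 (j, ε) = (σ j, ε) := rfl

lemma signChange_apply (i : ℕ) (j : Fin r) (ε : ℤˣ) :
    (signChange r i).1 (j, ε) = (j, if j.val = i then -ε else ε) := rfl

lemma simple_of_eq_zero {i : Fin r} (hi : i.val = 0) : simple i = signChange r 0 := if_pos hi

lemma simple_of_pos {i : Fin r} (hi : 0 < i.val) :
    simple i = letterPerm (Equiv.swap (prev i) i) := if_neg hi.ne'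

lemma window_mul_letterPerm (w : W r) (σ : Equiv.Perm (Fin r)) :
    window (w * letterPerm σ) = window w ∘ σ := rfl

lemma window_mul_simple_of_pos (w : W r) {i : Fin r} (hi : 0 < i.val) :
    window (w * simple i) = window w ∘ Equiv.swap (prev i) i := by
  rw [simple_of_pos hi, window_mul_letterPerm]

lemma window_mul_signChange_self (w : W r) (i : Fin r) :
    window (w * signChange r i) i = -window w i := by
  change letterVal (w.1 ((signChange r i).1 (i, 1))) = _
  rw [signChange_apply, if_pos rfl, apply_neg, letterVal_neg]
  rfl

lemma window_mul_signChange_of_ne (w : W r) {i : ℕ} {j : Fin r} (h : j.val ≠ i) :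
    window (w * signChange r i) j = window w j := by
  change letterVal (w.1 ((signChange r i).1 (j, 1))) = _
  rw [signChange_apply, if_neg h]
  rfl

lemma signChange_mul_self (i : ℕ) : signChange r i * signChange r i = 1 := by
  apply Subtype.ext
  apply Equiv.ext
  rintro ⟨j, ε⟩
  change (signChange r i).1 ((signChange r i).1 (j, ε)) = (j, ε)
  rw [signChange_apply, signChange_apply]
  by_cases h : j.val = i <;> simp [h]

lemma simple_mul_self (i : Fin r) : simple i * simple i = 1 := by
  rcases Nat.eq_zero_or_pos i.val with hi | hi
  · rw [simple_of_eq_zero hi, signChange_mul_self]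
  · rw [simple_of_pos hi]
    apply Subtype.ext
    apply Equiv.ext
    rintro ⟨j, ε⟩
    change (letterPerm _).1 ((letterPerm _).1 (j, ε)) = (j, ε)
    rw [letterPerm_apply, letterPerm_apply, Equiv.swap_apply_self]

lemma mul_simple_simple (w : W r) (i : Fin r) : w * simple i * simple i = w := by
  rw [mul_assoc, simple_mul_self, mul_one]

lemma simple_inv (i : Fin r) : (simple i)⁻¹ = simple i :=
  inv_eq_of_mul_eq_one_left (simple_mul_self i)

/-- `w` sends the `i`-th simple root to a positive root. -/
def IsAscent (w : W r) (i : Fin r) : Prop :=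
  if i.val = 0 then 0 < window w i else window w (prev i) < window w i

lemma isAscent_of_eq_zero {w : W r} {i : Fin r} (hi : i.val = 0) :
    IsAscent w i ↔ 0 < window w i := by rw [IsAscent, if_pos hi]

lemma isAscent_of_pos {w : W r} {i : Fin r} (hi : 0 < i.val) :
    IsAscent w i ↔ window w (prev i) < window w i := by rw [IsAscent, if_neg hi.ne']

lemma prev_ne {i : Fin r} (hi : 0 < i.val) : prev i ≠ i := by
  rw [Ne, Fin.ext_iff]
  simp only
  omega

/-- Window entries are nonzero and distinct, so failing to be an ascent is a strict inequality the
other way. -/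
lemma isAscent_mul_simple (w : W r) (i : Fin r) : IsAscent (w * simple i) i ↔ ¬ IsAscent w i := by
  rcases Nat.eq_zero_or_pos i.val with hi | hi
  · have h1 := window_mul_signChange_self w i
    rw [hi, ← simple_of_eq_zero hi] at h1
    rw [isAscent_of_eq_zero hi, isAscent_of_eq_zero hi, h1]
    have := window_ne_zero w i
    omega
  · rw [isAscent_of_pos hi, isAscent_of_pos hi, window_mul_simple_of_pos w hi]
    simp only [Function.comp_apply, Equiv.swap_apply_left, Equiv.swap_apply_right]
    have := (window_injective w).ne (prev_ne hi)
    omega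

lemma invCount_mul_simple {w : W r} {i : Fin r} (h : IsAscent w i) :
    invCount (window (w * simple i)) = invCount (window w) + 1 := by
  rcases Nat.eq_zero_or_pos i.val with hi | hi
  · refine invCount_neg _ _ hi ((isAscent_of_eq_zero hi).1 h) ?_ fun j hj => ?_
    · have h1 := window_mul_signChange_self w i
      rwa [hi, ← simple_of_eq_zero hi] at h1
    · rw [simple_of_eq_zero hi]
      exact window_mul_signChange_of_ne w fun h0 => hj (Fin.ext (h0.trans hi.symm))
  · rw [window_mul_simple_of_pos w hi]
    exact invCount_swap _ hi ((isAscent_of_pos hi).1 h)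

lemma invCount_mul_simple_add_one {w : W r} {i : Fin r} (h : ¬ IsAscent w i) :
    invCount (window (w * simple i)) + 1 = invCount (window w) := by
  rw [← invCount_mul_simple ((isAscent_mul_simple w i).2 h), mul_simple_simple]

lemma window_one (j : Fin r) : window 1 j = (j.val : ℤ) + 1 := by
  change ((1 : ℤˣ) : ℤ) * _ = _
  simp

lemma ext_window {w w' : W r} (h : ∀ j, window w j = window w' j) : w = w' := by
  apply Subtype.ext
  apply Equiv.ext
  rintro ⟨j, ε⟩
  have h1 : w.1 (j, 1) = w'.1 (j, 1) := letterVal_injective (h j)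
  rcases Int.units_eq_one_or ε with rfl | rfl
  · exact h1
  · rw [apply_neg, apply_neg, h1]

lemma window_le (w : W r) (j : Fin r) : window w j ≤ r := by
  unfold window letterVal
  have := (w.1 (j, 1)).1.isLt
  rcases Int.units_eq_one_or (w.1 (j, 1)).2 with h | h <;>
    simp only [h, Units.val_one, Units.val_neg, one_mul, neg_mul] <;> omega

/-- The window is then a strictly increasing sequence of `r` positive integers bounded by `r`, which
leaves only `1, …, r`. The lower bounds propagate from the left, the upper bounds from the right. -/
lemma eq_one_of_forall_isAscent {w : W r} (h : ∀ i, IsAscent w i) : w = 1 := by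
  have low : ∀ n (hn : n < r), (n : ℤ) + 1 ≤ window w ⟨n, hn⟩ := by
    intro n
    induction n with
    | zero =>
      intro hn
      have := (isAscent_of_eq_zero (i := ⟨0, hn⟩) rfl).1 (h _)
      push_cast
      omega
    | succ n ih =>
      intro hn
      have h1 := (isAscent_of_pos (i := ⟨n + 1, hn⟩) (Nat.succ_pos n)).1 (h _)
      have h2 := ih (by omega)
      change window w ⟨n, _⟩ < _ at h1
      push_cast
      linarith
  have high : ∀ d n (hn : n < r), n + d + 1 = r → window w ⟨n, hn⟩ ≤ (n : ℤ) + 1 := by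
    intro d
    induction d with
    | zero =>
      intro n hn hd
      have := window_le w ⟨n, hn⟩
      omega
    | succ d ih =>
      intro n hn hd
      have h1 := (isAscent_of_pos (i := ⟨n + 1, by omega⟩) (Nat.succ_pos n)).1 (h _)
      have h2 := ih (n + 1) (by omega) (by omega)
      change window w ⟨n, _⟩ < _ at h1
      push_cast at h2
      linarith
  refine ext_window fun j => ?_
  rw [window_one]
  exact le_antisymm (high (r - 1 - j.val) j.val j.isLt (by have := j.isLt; omega))
    (low j.val j.isLt)

lemma invCount_window_one : invCount (window (1 : W r)) = 0 := by
  have h1 : invSet (window (1 : W r)) = ∅ := by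
    ext ⟨a, b, ε⟩
    simp only [mem_invSet, window_one, Finset.notMem_empty, iff_false, not_and, not_lt]
    intro hab
    rw [Fin.lt_def] at hab
    rcases Int.units_eq_one_or ε with rfl | rfl <;>
      simp only [Units.val_one, Units.val_neg, one_mul, neg_mul] <;> omega
  have h2 : (Finset.univ.filter fun j : Fin r => window 1 j < 0) = ∅ := by
    ext j
    simp only [window_one, Finset.mem_filter, Finset.mem_univ, true_and, Finset.notMem_empty,
      iff_false, not_lt]
    omega
  unfold invCount
  rw [h1, h2]
  rfl

lemma invCount_le_of_prod (l : List (Fin r)) :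
    invCount (window (l.map simple).prod) ≤ l.length := by
  induction l using List.reverseRecOn with
  | nil => simp [invCount_window_one]
  | append_singleton l i ih =>
    simp only [List.map_append, List.map_singleton, List.prod_append, List.prod_singleton,
      List.length_append, List.length_singleton]
    by_cases h : IsAscent (l.map simple).prod i
    · rw [invCount_mul_simple h]
      omega
    · have := invCount_mul_simple_add_one h
      omega

/-- An element other than `1` has a descent, and removing it lowers `invCount`. This induction
replaces reduced words. -/
lemma induction_on_ascents {P : W r → Prop} (one : P 1)
    (mul_simple : ∀ w i, IsAscent w i → P w → P (w * simple i)) (w : W r) : P w := by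
  induction hn : invCount (window w) using Nat.strong_induction_on generalizing w with
  | _ n ih =>
    by_cases h : ∀ i, IsAscent w i
    · rwa [eq_one_of_forall_isAscent h]
    · push Not at h
      obtain ⟨i, hi⟩ := h
      have h1 := invCount_mul_simple_add_one hi
      have h2 := mul_simple _ i ((isAscent_mul_simple w i).2 hi) (ih _ (by omega) _ rfl)
      rwa [mul_simple_simple] at h2

lemma exists_word (w : W r) :
    ∃ l : List (Fin r), l.length = invCount (window w) ∧ (l.map simple).prod = w := by
  induction w using induction_on_ascents with
  | one => exact ⟨[], by simp [invCount_window_one], rfl⟩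
  | mul_simple w i h ih =>
    obtain ⟨l, hlen, hprod⟩ := ih
    exact ⟨l ++ [i], by simp [invCount_mul_simple h, hlen], by simp [hprod]⟩

lemma length_eq_invCount (w : W r) : length w = invCount (window w) := by
  obtain ⟨l, hlen, hprod⟩ := exists_word w
  apply le_antisymm
  · exact Nat.sInf_le ⟨l, hlen, hprod⟩
  · obtain ⟨l', hlen', hprod'⟩ := Nat.sInf_mem
      (s := {k : ℕ | ∃ l : List (Fin r), l.length = k ∧ (l.map simple).prod = w})
      ⟨_, l, hlen, hprod⟩
    have := invCount_le_of_prod l'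
    rw [hprod', hlen'] at this
    exact this

lemma length_one : length (1 : W r) = 0 := by
  rw [length_eq_invCount, invCount_window_one]

lemma length_mul_simple {w : W r} {i : Fin r} (h : IsAscent w i) :
    length (w * simple i) = length w + 1 := by
  rw [length_eq_invCount, length_eq_invCount, invCount_mul_simple h]

lemma isAscent_one (i : Fin r) : IsAscent 1 i := by
  rcases Nat.eq_zero_or_pos i.val with hi | hi
  · rw [isAscent_of_eq_zero hi, window_one]
    omega
  · rw [isAscent_of_pos hi, window_one, window_one]
    simp only
    omega

lemma length_simple (i : Fin r) : length (simple i) = 1 := by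
  have := length_mul_simple (isAscent_one i)
  rwa [one_mul, length_one] at this

lemma length_inv_le (w : W r) : length w⁻¹ ≤ length w := by
  obtain ⟨l, hlen, hprod⟩ := exists_word w
  rw [← length_eq_invCount] at hlen
  refine Nat.sInf_le ⟨l.reverse, by simp [hlen], ?_⟩
  rw [← hprod, List.prod_inv_reverse, List.map_map, List.map_reverse]
  congr 3
  funext i
  exact (simple_inv i).symm

lemma length_inv (w : W r) : length w⁻¹ = length w :=
  le_antisymm (length_inv_le w) (by simpa using length_inv_le w⁻¹)

lemma length_simple_mul {w : W r} {i : Fin r} (h : IsAscent w⁻¹ i) :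
    length (simple i * w) = length w + 1 := by
  rw [← length_inv, mul_inv_rev, simple_inv, length_mul_simple h, length_inv]

end Length

/-! ## Jucys–Murphy elements in rings with braid relations of type `B` -/

section JucysMurphy

variable {A : Type*} [Ring A]

/-- The elements `x₀`, `S₁ x₀ S₁`, `S₂ S₁ x₀ S₁ S₂`, …. -/
def jm (S : ℕ → A) (x₀ : A) : ℕ → A
  | 0 => x₀
  | i + 1 => S (i + 1) * jm S x₀ i * S (i + 1)

lemma jm_zero (S : ℕ → A) (x₀ : A) : jm S x₀ 0 = x₀ := rfl

lemma jm_succ (S : ℕ → A) (x₀ : A) (i : ℕ) :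
    jm S x₀ (i + 1) = S (i + 1) * jm S x₀ i * S (i + 1) := rfl

/-- The elements `S₁, …, S_{r-1}` satisfy the braid relations of type `A`, and together with `x₀`
those of type `B`. -/
structure IsBraid (r : ℕ) (S : ℕ → A) (x₀ : A) : Prop where
  braid : ∀ i, 0 < i → i + 1 < r → S i * S (i + 1) * S i = S (i + 1) * S i * S (i + 1)
  comm : ∀ i j, 0 < i → i + 2 ≤ j → j < r → Commute (S i) (S j)
  comm_zero : ∀ j, 2 ≤ j → j < r → Commute x₀ (S j)
  braid_zero : 1 < r → Commute x₀ (S 1 * x₀ * S 1)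

namespace IsBraid

variable {r : ℕ} {S : ℕ → A} {x₀ : A} (h : IsBraid r S x₀)

include h

lemma commute_jm_of_lt {i j : ℕ} (hij : i + 2 ≤ j) (hj : j < r) : Commute (S j) (jm S x₀ i) := by
  induction i with
  | zero => exact (h.comm_zero j hij hj).symm
  | succ i ih =>
    have h1 : Commute (S j) (S (i + 1)) := (h.comm (i + 1) j (by omega) (by omega) hj).symm
    exact (h1.mul_right (ih (by omega))).mul_right h1

/-- Peeling off outer factors reduces to `i = j + 1`. With `s`, `t` the two adjacent generators and
`a` commuting with `t`, two braid moves carry `s` through `t s a s t`. -/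
lemma commute_jm_of_gt {i j : ℕ} (h0 : 0 < j) (hij : j < i) (hi : i < r) :
    Commute (S j) (jm S x₀ i) := by
  induction i with
  | zero => omega
  | succ i ih =>
    rcases Nat.lt_or_ge j i with hlt | hge
    · have h1 : Commute (S j) (S (i + 1)) := h.comm j (i + 1) h0 (by omega) hi
      exact (h1.mul_right (ih hlt (by omega))).mul_right h1
    · obtain rfl : j = i := by omega
      obtain ⟨j, rfl⟩ : ∃ k, j = k + 1 := ⟨j - 1, by omega⟩
      rw [jm_succ, jm_succ]
      have hb := h.braid (j + 1) (by omega) hi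
      have hc : Commute (S (j + 1 + 1)) (jm S x₀ j) := h.commute_jm_of_lt (by omega) hi
      set s := S (j + 1)
      set t := S (j + 1 + 1)
      set a := jm S x₀ j
      change s * (t * (s * a * s) * t) = t * (s * a * s) * t * s
      calc s * (t * (s * a * s) * t) = (s * t * s) * a * s * t := by noncomm_ring
        _ = t * s * (t * a) * s * t := by rw [hb]; noncomm_ring
        _ = t * s * a * (t * s * t) := by rw [hc.eq]; noncomm_ring
        _ = t * s * a * (s * t * s) := by rw [hb]
        _ = _ := by noncomm_ring

/-- In the inductive step, `t s a s t` commutes with `s` by `commute_jm_of_gt`, and with `a` because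
`t` does and, by induction, `s a s` does. Hence it commutes with `s a s`. -/
lemma commute_jm_succ {i : ℕ} (hi : i + 1 < r) : Commute (jm S x₀ i) (jm S x₀ (i + 1)) := by
  induction i with
  | zero => exact h.braid_zero hi
  | succ i ih =>
    have ih := (ih (by omega)).eq
    have hb := h.braid (i + 1) (by omega) hi
    have hc : Commute (S (i + 1 + 1)) (jm S x₀ i) := h.commute_jm_of_lt (by omega) hi
    have hd := h.commute_jm_of_gt (x₀ := x₀) (i := i + 1 + 1) (j := i + 1) (by omega) (by omega) hi
    rw [jm_succ, jm_succ] at hd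
    rw [jm_succ] at ih
    rw [jm_succ S x₀ (i + 1), jm_succ]
    set s := S (i + 1)
    set t := S (i + 1 + 1)
    set a := jm S x₀ i
    have hd' : Commute a (t * (s * a * s) * t) := by
      change a * (t * (s * a * s) * t) = t * (s * a * s) * t * a
      calc a * (t * (s * a * s) * t) = (a * t) * s * a * s * t := by noncomm_ring
        _ = t * (a * (s * a * s)) * t := by rw [← hc.eq]; noncomm_ring
        _ = t * s * a * s * (a * t) := by rw [ih]; noncomm_ring
        _ = _ := by rw [← hc.eq]; noncomm_ring
    exact (hd.mul_left hd').mul_left hd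

lemma commute_jm_of_le {i j : ℕ} (hij : i ≤ j) (hj : j < r) :
    Commute (jm S x₀ i) (jm S x₀ j) := by
  induction j with
  | zero =>
    obtain rfl : i = 0 := by omega
    exact Commute.refl _
  | succ j ih =>
    rcases Nat.lt_or_ge i j with hlt | hge
    · have h1 := (h.commute_jm_of_lt (i := i) (j := j + 1) (by omega) hj).symm
      exact (h1.mul_right (ih hlt.le (by omega))).mul_right h1
    · rcases Nat.eq_or_lt_of_le hij with rfl | hlt
      · exact Commute.refl _
      · obtain rfl : i = j := by omega
        exact h.commute_jm_succ hj

lemma commute_jm {i j : ℕ} (hi : i < r) (hj : j < r) : Commute (jm S x₀ i) (jm S x₀ j) := by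
  rcases le_total i j with hij | hij
  · exact h.commute_jm_of_le hij hj
  · exact (h.commute_jm_of_le hij hi).symm

end IsBraid

end JucysMurphy

/-! ## The elements `π_a` -/

section Pi

variable {R A : Type*} [CommRing R] [Ring A] [Algebra R A]

/-- The elements `S₀, …, S_{r-1}` satisfy the relations of the Hecke algebra of type `B_r`. -/
structure IsHecke (r : ℕ) (S : ℕ → A) (q₀ q : R) : Prop where
  quad_zero : 0 < r → S 0 * S 0 = (q₀ - 1) • S 0 + algebraMap R A q₀
  quad : ∀ i, 0 < i → i < r → S i * S i = (q - 1) • S i + algebraMap R A q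
  isBraid : IsBraid r S (S 0)

/-- The product of the `q ^ i + L_i`, `i < a`, where the `L_i` are the Jucys–Murphy elements
starting with `S₀`. -/
def piProd (S : ℕ → A) (q : R) (a : ℕ) : A :=
  ((List.range a).map fun i => algebraMap R A (q ^ i) + jm S (S 0) i).prod

/-- The product of the `q ^ i + q₀ M_i`, `i < a`, where the `M_i` are the Jucys–Murphy elements
starting with `1`. -/
def zProd (S : ℕ → A) (q₀ q : R) (a : ℕ) : A :=
  ((List.range a).map fun i => algebraMap R A (q ^ i) + q₀ • jm S 1 i).prod

lemma piProd_succ (S : ℕ → A) (q : R) (a : ℕ) :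
    piProd S q (a + 1) = piProd S q a * (algebraMap R A (q ^ a) + jm S (S 0) a) := by
  simp [piProd, List.range_succ]

lemma zProd_succ (S : ℕ → A) (q₀ q : R) (a : ℕ) :
    zProd S q₀ q (a + 1) = zProd S q₀ q a * (algebraMap R A (q ^ a) + q₀ • jm S 1 a) := by
  simp [zProd, List.range_succ]

namespace IsHecke

variable {r : ℕ} {S : ℕ → A} {q₀ q : R} (h : IsHecke r S q₀ q)

include h

/-- Starting from `1` instead of `S 0`, the general commutation results apply to the type `A`
elements `M_i` as well. -/
lemma isBraid_one : IsBraid r S 1 where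
  braid := h.isBraid.braid
  comm := h.isBraid.comm
  comm_zero _ _ _ := Commute.one_left _
  braid_zero _ := Commute.one_left _

lemma commute_piProd_of_gt {a j : ℕ} (haj : a < j) (hj : j < r) :
    Commute (S j) (piProd S q a) := by
  induction a with
  | zero => exact Commute.one_right _
  | succ a ih =>
    rw [piProd_succ]
    exact (ih (by omega)).mul_right
      ((Algebra.commute_algebraMap_right _ _).add_right (h.isBraid.commute_jm_of_lt (by omega) hj))

/-- Only the two factors with indices `j - 1` and `j` are not handled one by one. Writing `L` and `s
L s` for their Jucys–Murphy elements, their product is a combination of `1`, `q L + s L s` and `L s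
L s`; the second commutes with `s` by the quadratic relation, the third because `L` and `s L s`
commute. -/
lemma commute_piProd_of_lt {a j : ℕ} (h0 : 0 < j) (hja : j < a) (har : a ≤ r) :
    Commute (S j) (piProd S q a) := by
  induction a with
  | zero => omega
  | succ a ih =>
    rcases Nat.lt_or_ge j a with hlt | hge
    · rw [piProd_succ]
      exact (ih hlt (by omega)).mul_right
        ((Algebra.commute_algebraMap_right _ _).add_right (h.isBraid.commute_jm_of_gt h0 hlt (by omega)))
    · obtain rfl : j = a := by omega
      obtain ⟨j, rfl⟩ : ∃ k, j = k + 1 := ⟨j - 1, by omega⟩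
      rw [piProd_succ, piProd_succ, mul_assoc]
      refine (h.commute_piProd_of_gt (by omega) (by omega)).mul_right ?_
      have hq := h.quad (j + 1) h0 (by omega)
      have hc := (h.isBraid.commute_jm_succ (i := j) (by omega)).eq
      rw [jm_succ] at hc ⊢
      set s := S (j + 1)
      set L := jm S (S 0) j
      change s * ((algebraMap R A (q ^ j) + L) * (algebraMap R A (q ^ (j + 1)) + s * L * s)) =
        (algebraMap R A (q ^ j) + L) * (algebraMap R A (q ^ (j + 1)) + s * L * s) * s
      have e1 : s * (L * (s * L * s)) = L * (s * L * s) * s := by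
        rw [← mul_assoc, ← mul_assoc] at hc
        calc s * (L * (s * L * s)) = (s * L * s * L) * s := by noncomm_ring
          _ = _ := by rw [← hc, ← mul_assoc, ← mul_assoc]
      have e2 : s * (q • L + s * L * s) = (q • L + s * L * s) * s := by
        have h1 : s * (s * L * s) = (s * s) * L * s := by noncomm_ring
        have h2 : s * L * s * s = s * L * (s * s) := by noncomm_ring
        rw [mul_add, add_mul, h1, h2, hq]
        simp only [Algebra.algebraMap_eq_smul_one, add_mul, mul_add, smul_mul_assoc,
          mul_smul_comm, one_mul, mul_one]
        abel
      have e3 : (algebraMap R A (q ^ j) + L) * (algebraMap R A (q ^ (j + 1)) + s * L * s) =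
          algebraMap R A (q ^ j * q ^ (j + 1)) + q ^ j • (q • L + s * L * s) +
            L * (s * L * s) := by
        simp only [Algebra.algebraMap_eq_smul_one, add_mul, mul_add, smul_mul_assoc,
          mul_smul_comm, one_mul, mul_one, smul_add, smul_smul, pow_succ]
        rw [mul_comm (q ^ j) (q ^ j * q)]
        abel
      rw [e3, mul_add, add_mul, e1, mul_add, add_mul, mul_smul_comm, e2, smul_mul_assoc,
        Algebra.commutes]

/-- The first factor is `1 + S 0`, and the quadratic relation reads `(S 0 - q₀)(S 0 + 1) = 0`. -/
lemma zero_mul_piProd {a : ℕ} (ha : 0 < a) (har : a ≤ r) :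
    S 0 * piProd S q a = q₀ • piProd S q a := by
  induction a with
  | zero => omega
  | succ a ih =>
    rw [piProd_succ]
    rcases Nat.eq_zero_or_pos a with rfl | ha'
    · simp only [piProd, List.range_zero, List.map_nil, List.prod_nil, one_mul, pow_zero, map_one,
        jm_zero, mul_add, mul_one, h.quad_zero (by omega), Algebra.algebraMap_eq_smul_one,
        smul_add, sub_smul, one_smul]
      abel
    · rw [← mul_assoc, ih ha' (by omega), smul_mul_assoc]

lemma commute_jm_piProd {a i : ℕ} (har : a ≤ r) (hi : i < r) :
    Commute (jm S (S 0) i) (piProd S q a) := by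
  induction a with
  | zero => exact Commute.one_right _
  | succ a ih =>
    rw [piProd_succ]
    exact (ih (by omega)).mul_right
      ((Algebra.commute_algebraMap_right _ _).add_right (h.isBraid.commute_jm hi (by omega)))

lemma commute_one_jm_piProd {a i : ℕ} (har : a ≤ r) (hi : i < a) :
    Commute (jm S 1 i) (piProd S q a) := by
  induction i with
  | zero => exact Commute.one_left _
  | succ i ih =>
    have h1 : Commute (S (i + 1)) (piProd S q a) := h.commute_piProd_of_lt (by omega) hi har
    exact (h1.mul_left (ih (by omega))).mul_left h1

/-- The outer generators of `L_i` commute with `π_a`, and the central `S 0` is absorbed as `q₀`. -/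
lemma piProd_mul_jm {a i : ℕ} (har : a ≤ r) (hi : i < a) :
    piProd S q a * jm S (S 0) i = q₀ • (piProd S q a * jm S 1 i) := by
  induction i with
  | zero =>
    rw [← (h.commute_jm_piProd har (by omega)).eq, jm_zero, jm_zero, mul_one,
      h.zero_mul_piProd (by omega) har]
  | succ i ih =>
    have h1 : Commute (S (i + 1)) (piProd S q a) := h.commute_piProd_of_lt (by omega) hi har
    rw [jm_succ, jm_succ, ← mul_assoc, ← mul_assoc, ← h1.eq, mul_assoc (S (i + 1)),
      ih (by omega), mul_smul_comm, smul_mul_assoc, ← mul_assoc, ← mul_assoc, ← mul_assoc, h1.eq]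

lemma commute_zProd_piProd {a b : ℕ} (har : a ≤ r) (hb : b ≤ a) :
    Commute (zProd S q₀ q b) (piProd S q a) := by
  induction b with
  | zero => exact Commute.one_left _
  | succ b ih =>
    rw [zProd_succ]
    exact (ih (by omega)).mul_left (Commute.add_left (Algebra.commutes _ _)
      ((h.commute_one_jm_piProd har (by omega)).smul_left q₀))

/-- The factors of the second product are converted one at a time; the part already converted
commutes with `π_a`, which can thus be moved next to the following factor. -/
lemma piProd_mul_piProd_of_le {a b : ℕ} (har : a ≤ r) (hb : b ≤ a) :
    piProd S q a * piProd S q b = piProd S q a * zProd S q₀ q b := by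
  induction b with
  | zero => rfl
  | succ b ih =>
    have hc := (h.commute_zProd_piProd har (b := b) (by omega)).eq
    rw [piProd_succ, zProd_succ, ← mul_assoc, ← mul_assoc, ih (by omega), ← hc, mul_assoc,
      mul_assoc]
    congr 1
    rw [mul_add, mul_add, h.piProd_mul_jm har (by omega), mul_smul_comm]

lemma piProd_mul_self {a : ℕ} (har : a ≤ r) :
    piProd S q a * piProd S q a = zProd S q₀ q a * piProd S q a := by
  rw [h.piProd_mul_piProd_of_le har le_rfl, (h.commute_zProd_piProd har le_rfl).eq]

end IsHecke

end Pi

/-! ## Invertibility of `q ^ i + q₀ M_i` -/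

section Invertible

variable {R A : Type*} [CommRing R] [Ring A] [Algebra R A]

/-- The product of the `x - c`, for `c` in a list of scalars. -/
def rootProd (l : List R) (x : A) : A := (l.map fun c => x - algebraMap R A c).prod

lemma rootProd_cons (c : R) (l : List R) (x : A) :
    rootProd (c :: l) x = (x - algebraMap R A c) * rootProd l x := by
  simp [rootProd]

lemma rootProd_append (l l' : List R) (x : A) :
    rootProd (l ++ l') x = rootProd l x * rootProd l' x := by
  simp [rootProd]

lemma commute_rootProd (l : List R) {x y : A} (hxy : Commute x y) : Commute x (rootProd l y) := by
  induction l with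
  | nil => exact Commute.one_right _
  | cons c l ih =>
    rw [rootProd_cons]
    exact (hxy.sub_right (Algebra.commutes c x).symm).mul_right ih

/-- An intertwiner `w` carries an eigenvalue `c` of `x` to the eigenvalue `κ c` of `y`. -/
lemma rootProd_mul_of_mul_eq (κ : R) (l : List R) {x y w : A} (h : y * w = κ • (w * x)) :
    rootProd (l.map (κ * ·)) y * w = κ ^ l.length • (w * rootProd l x) := by
  induction l with
  | nil => simp [rootProd]
  | cons c l ih =>
    have hw : (y - algebraMap R A (κ * c)) * w = κ • (w * (x - algebraMap R A c)) := by
      simp only [sub_mul, mul_sub, h, Algebra.algebraMap_eq_smul_one, smul_mul_assoc,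
        mul_smul_comm, one_mul, mul_one, smul_sub, smul_smul]
    have hc : Commute (y - algebraMap R A (κ * c)) (rootProd (l.map (κ * ·)) y) :=
      commute_rootProd _ ((Commute.refl y).sub_left (Algebra.commutes _ _))
    have hc' : Commute (x - algebraMap R A c) (rootProd l x) :=
      commute_rootProd _ ((Commute.refl x).sub_left (Algebra.commutes _ _))
    rw [List.map_cons, rootProd_cons, rootProd_cons, hc.eq, mul_assoc, hw, mul_smul_comm,
      ← mul_assoc, ih, hc'.eq, smul_mul_assoc, smul_smul, mul_assoc, List.length_cons, pow_succ']

lemma rootProd_mul_eq_zero (κ : R) {l : List R} {x y w : A} (h : y * w = κ • (w * x))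
    (hx : rootProd l x = 0) : rootProd (l.map (κ * ·)) y * w = 0 := by
  rw [rootProd_mul_of_mul_eq κ l h, hx, mul_zero, smul_zero]

/-- If `x` is annihilated by the monic polynomial with roots `c`, then `s x s` is annihilated by the
one with roots `c`, `q c` and `q² c`, provided that `s` satisfies the Hecke relation and `s x s`
commutes with `x`. -/
lemma rootProd_conj_eq_zero {q : R} {l : List R} {s x : A}
    (hs : s * s = (q - 1) • s + algebraMap R A q) (hc : Commute x (s * x * s))
    (hx : rootProd l x = 0) :
    rootProd (l ++ (l.map (q ^ 2 * ·) ++ l.map (q * ·))) (s * x * s) = 0 := by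
  set y := s * x * s with hy
  have hys : y * s = (q - 1) • y + q • (s * x) := by
    calc y * s = s * x * (s * s) := by rw [hy]; noncomm_ring
      _ = _ := by
        rw [hs, hy]
        simp only [Algebra.algebraMap_eq_smul_one, mul_add, mul_smul_comm, mul_one]
  -- The rank one intertwiner: it carries eigenvalues `c` of `x` to `q c` of `y`. Where it vanishes,
  -- its square forces `y = x` or `y = q² x`, which accounts for the other two families of roots.
  set φ := s * x - x * s with hφ
  have hyφ : y * φ = q • (φ * x) := by
    calc y * φ = (y * s) * x - (y * x) * s := by rw [hφ]; noncomm_ring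
      _ = (y * s) * x - x * (y * s) := by rw [← hc.eq]; noncomm_ring
      _ = ((q - 1) • y + q • (s * x)) * x - x * ((q - 1) • y + q • (s * x)) := by rw [hys]
      _ = _ := by
        rw [hφ]
        simp only [add_mul, mul_add, smul_mul_assoc, mul_smul_comm, sub_mul, smul_sub, hc.eq,
          mul_assoc]
        abel
  have hφφ : q • (φ * φ) = -((y - q ^ 2 • x) * (y - x)) := by
    have h1 : q • (s * x * (x * s)) = y * y - (q - 1) • (y * (x * s)) := by
      have e : y * s * (x * s) = y * y := by rw [hy]; noncomm_ring
      rw [← e, hys, add_mul, smul_mul_assoc, smul_mul_assoc, add_sub_cancel_left]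
    have h2 : q • (x * (s * x)) = x * y * s - (q - 1) • (x * y) := by
      rw [mul_assoc x y s, hys, mul_add, mul_smul_comm, mul_smul_comm, add_sub_cancel_left]
    have h3 : x * s * (s * x) = (q - 1) • (x * (s * x)) + q • (x * x) := by
      calc x * s * (s * x) = x * (s * s) * x := by noncomm_ring
        _ = _ := by
          rw [hs]
          simp only [Algebra.algebraMap_eq_smul_one, mul_add, add_mul, mul_smul_comm,
            smul_mul_assoc, mul_one, mul_assoc]
    have h4 : φ * φ = y * x - s * x * (x * s) - x * s * (s * x) + x * y := by
      rw [hφ, hy]; noncomm_ring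
    have h5 : x * y * s = y * (x * s) := by rw [hc.eq, mul_assoc]
    rw [h4, smul_add, smul_sub, smul_sub, h1, h3, smul_add, smul_comm q (q - 1), h2, h5]
    simp only [sub_mul, mul_sub, smul_mul_assoc, smul_sub, sub_smul, one_smul, hc.eq, smul_smul,
      pow_two, one_mul]
    abel
  have e1 : rootProd (l.map (q * ·)) y * φ = 0 := rootProd_mul_eq_zero q hyφ hx
  have hcy : ∀ l' : List R, Commute x (rootProd l' y) := fun l' => commute_rootProd l' hc
  have hyy : ∀ l' : List R, Commute y (rootProd l' y) := fun l' =>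
    commute_rootProd l' (Commute.refl y)
  have e2 : rootProd (l.map (q * ·)) y * ((y - q ^ 2 • x) * (y - x)) = 0 := by
    rw [← neg_eq_zero, ← mul_neg, ← hφφ, mul_smul_comm, ← mul_assoc, e1, zero_mul, smul_zero]
  set p := rootProd (l.map (q * ·)) y with hp
  have hxp : Commute x p := hcy _
  have hyp : Commute y p := hyy _
  -- By `e2`, `p (y - x)` is an intertwiner with factor `q²`; once the roots `q² c` have been used,
  -- `p' p` is one with factor `1`.
  have e3 : y * (p * (y - x)) = q ^ 2 • (p * (y - x) * x) := by
    rw [← sub_eq_zero, ← e2]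
    have h1 : y * (p * (y - x)) = p * (y * (y - x)) := by rw [← mul_assoc, hyp.eq, mul_assoc]
    have h2 : (y - x) * x = x * (y - x) := by rw [sub_mul, mul_sub, hc.eq]
    rw [h1, mul_assoc p, h2, sub_mul y, smul_mul_assoc, mul_sub p, mul_smul_comm]
  have e4 := rootProd_mul_eq_zero (q ^ 2) e3 hx
  rw [← mul_assoc] at e4
  set p' := rootProd (l.map (q ^ 2 * ·)) y with hp'
  have e5 : y * (p' * p) = (1 : R) • ((p' * p) * x) := by
    rw [one_smul, ← ((hcy _).mul_right hxp).eq, ((hyy _).mul_right hyp).eq,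
      ((hcy (l.map (q ^ 2 * ·))).mul_right hxp).eq]
    rwa [mul_sub, sub_eq_zero] at e4
  have e6 := rootProd_mul_eq_zero 1 e5 hx
  simp only [one_mul, List.map_id'] at e6
  rw [rootProd_append, rootProd_append]
  exact e6

/-- The difference `(u + v X) - v (X - c)` is the unit `u + v c`, so `u + v X` is coprime to each `X
- c` and hence to their product. Evaluating the Bézout identity at `x` gives the inverse. -/
lemma isUnit_of_rootProd_eq_zero {u v : R} {l : List R} {x : A} (hx : rootProd l x = 0)
    (h : ∀ c ∈ l, IsUnit (u + v * c)) : IsUnit (algebraMap R A u + v • x) := by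
  open Polynomial in
  have hco : IsCoprime (C u + C v * X : R[X]) (l.map fun c => X - C c).prod := by
    clear hx
    induction l with
    | nil => exact isCoprime_one_right
    | cons c l ih =>
      rw [List.map_cons, List.prod_cons]
      refine IsCoprime.mul_right ?_ (ih fun d hd => h d (List.mem_cons_of_mem _ hd))
      obtain ⟨w, hw⟩ := (h c List.mem_cons_self).exists_right_inv
      refine ⟨C w, -(C w * C v), ?_⟩
      rw [← C_1, ← hw]
      simp only [C_mul, C_add]
      ring
  obtain ⟨a, b, hab⟩ := hco
  have h0 : Polynomial.aeval x (l.map fun c => Polynomial.X - Polynomial.C c).prod = 0 := by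
    rw [map_list_prod, List.map_map, ← hx]
    simp [rootProd, Function.comp_def]
  have h1 := congrArg (Polynomial.aeval x) hab
  rw [map_add, map_mul, map_mul _ b, h0, mul_zero, add_zero, map_one, map_add,
    map_mul _ (Polynomial.C v), Polynomial.aeval_C, Polynomial.aeval_C, Polynomial.aeval_X, ← Algebra.smul_def] at h1
  have h2 : (algebraMap R A u + v • x) * Polynomial.aeval x a = 1 := by
    rw [← h1]
    have : algebraMap R A u + v • x =
        Polynomial.aeval x (Polynomial.C u + Polynomial.C v * Polynomial.X) := by
      simp [Algebra.smul_def]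
    rw [this, ← map_mul, ← map_mul, mul_comm]
  exact ⟨⟨_, _, h2, h1⟩, rfl⟩

variable {r : ℕ} {S : ℕ → A} {q₀ q : R}

/-- From `M_0 = 1`, each conjugation multiplies roots by `1`, `q` or `q²`. The bound `2 * i` gives
`|i - k| ≤ i`, which is the range of exponents in `g_r`. -/
lemma IsHecke.exists_rootProd (h : IsHecke r S q₀ q) {i : ℕ} (hi : i < r) :
    ∃ l : List R, (∀ c ∈ l, ∃ k ≤ 2 * i, c = q ^ k) ∧ rootProd l (jm S 1 i) = 0 := by
  induction i with
  | zero => exact ⟨[1], by simp, by simp [rootProd, jm_zero]⟩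
  | succ i ih =>
    obtain ⟨l, hl, h0⟩ := ih (by omega)
    refine ⟨_, ?_, rootProd_conj_eq_zero (h.quad (i + 1) (by omega) hi)
      (h.isBraid_one.commute_jm_succ hi) h0⟩
    intro c hc
    simp only [List.mem_append, List.mem_map] at hc
    rcases hc with hc | ⟨d, hd, rfl⟩ | ⟨d, hd, rfl⟩
    · obtain ⟨k, hk, rfl⟩ := hl c hc
      exact ⟨k, by omega, rfl⟩
    · obtain ⟨k, hk, rfl⟩ := hl d hd
      exact ⟨2 + k, by omega, (pow_add _ _ _).symm⟩
    · obtain ⟨k, hk, rfl⟩ := hl d hd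
      exact ⟨k + 1, by omega, (pow_succ' _ _).symm⟩

lemma IsHecke.isUnit_zProd (h : IsHecke r S q₀ q)
    (hu : ∀ i < r, ∀ k ≤ 2 * i, IsUnit (q ^ i + q₀ * q ^ k)) {a : ℕ} (ha : a ≤ r) :
    IsUnit (zProd S q₀ q a) := by
  induction a with
  | zero => exact isUnit_one
  | succ a ih =>
    rw [zProd_succ]
    refine (ih (by omega)).mul ?_
    obtain ⟨l, hl, h0⟩ := h.exists_rootProd (i := a) (by omega)
    refine isUnit_of_rootProd_eq_zero h0 fun c hc => ?_
    obtain ⟨k, hk, rfl⟩ := hl c hc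
    exact hu a (by omega) k hk

end Invertible

/-! ## The generators of the Hecke algebra of type `B` -/

section Windows

variable {r : ℕ}

lemma isAscent_mk_zero {w : W r} (h : 0 < r) : IsAscent w ⟨0, h⟩ ↔ 0 < window w ⟨0, h⟩ :=
  isAscent_of_eq_zero rfl

lemma isAscent_mk_succ {w : W r} {i : ℕ} (h : i + 1 < r) :
    IsAscent w ⟨i + 1, h⟩ ↔ window w ⟨i, by omega⟩ < window w ⟨i + 1, h⟩ :=
  isAscent_of_pos (Nat.succ_pos i)

lemma window_mul_signChange (w : W r) (i k : ℕ) (hk : k < r) :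
    window (w * signChange r i) ⟨k, hk⟩ = if k = i then -window w ⟨k, hk⟩ else window w ⟨k, hk⟩ := by
  split_ifs with h
  · subst h
    exact window_mul_signChange_self w ⟨k, hk⟩
  · exact window_mul_signChange_of_ne w h

lemma window_mul_simple_zero (w : W r) (h : 0 < r) (k : ℕ) (hk : k < r) :
    window (w * simple ⟨0, h⟩) ⟨k, hk⟩ =
      if k = 0 then -window w ⟨k, hk⟩ else window w ⟨k, hk⟩ := by
  rw [simple_of_eq_zero rfl, window_mul_signChange]

lemma window_mul_simple_succ (w : W r) {i : ℕ} (h : i + 1 < r) (k : ℕ) (hk : k < r) :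
    window (w * simple ⟨i + 1, h⟩) ⟨k, hk⟩ =
      if k = i then window w ⟨i + 1, h⟩
      else if k = i + 1 then window w ⟨i, by omega⟩ else window w ⟨k, hk⟩ := by
  rw [window_mul_simple_of_pos w (Nat.succ_pos i), Function.comp_apply, Equiv.swap_apply_def]
  simp only [Fin.mk.injEq, prev, Nat.add_sub_cancel]
  split_ifs <;> rfl

lemma window_one_mk (k : ℕ) (hk : k < r) : window 1 ⟨k, hk⟩ = (k : ℤ) + 1 := window_one _

/-- The leading `1` lets each side be read as successive right multiplications, both for computing
windows and for expanding `T` letter by letter. -/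
lemma simple_braid {i : ℕ} (h : i + 2 < r) :
    (1 : W r) * simple ⟨i + 1, by omega⟩ * simple ⟨i + 2, h⟩ * simple ⟨i + 1, by omega⟩ =
      1 * simple ⟨i + 2, h⟩ * simple ⟨i + 1, by omega⟩ * simple ⟨i + 2, h⟩ := by
  refine ext_window fun ⟨k, hk⟩ => ?_
  simp only [window_mul_simple_succ, window_one_mk]
  split_ifs <;> omega

lemma simple_comm {i j : ℕ} (hij : i + 2 ≤ j) (hj : j + 1 < r) :
    (1 : W r) * simple ⟨i + 1, by omega⟩ * simple ⟨j + 1, hj⟩ =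
      1 * simple ⟨j + 1, hj⟩ * simple ⟨i + 1, by omega⟩ := by
  refine ext_window fun ⟨k, hk⟩ => ?_
  simp only [window_mul_simple_succ, window_one_mk]
  split_ifs <;> omega

lemma simple_zero_comm {j : ℕ} (hij : 1 ≤ j) (hj : j + 1 < r) :
    (1 : W r) * simple ⟨0, by omega⟩ * simple ⟨j + 1, hj⟩ =
      1 * simple ⟨j + 1, hj⟩ * simple ⟨0, by omega⟩ := by
  refine ext_window fun ⟨k, hk⟩ => ?_
  simp only [window_mul_simple_succ, window_mul_simple_zero, window_one_mk]
  (try split_ifs) <;> first | omega | simp_all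

lemma simple_braid_zero (h : 1 < r) :
    (1 : W r) * simple ⟨0, by omega⟩ * simple ⟨0 + 1, h⟩ * simple ⟨0, by omega⟩ *
      simple ⟨0 + 1, h⟩ =
      1 * simple ⟨0 + 1, h⟩ * simple ⟨0, by omega⟩ * simple ⟨0 + 1, h⟩ * simple ⟨0, by omega⟩ := by
  refine ext_window fun ⟨k, hk⟩ => ?_
  simp only [window_mul_simple_succ, window_mul_simple_zero, window_one_mk]
  (try split_ifs) <;> first | omega | simp_all

lemma signChange_succ {i : ℕ} (h : i + 1 < r) :
    signChange r (i + 1) = simple ⟨i + 1, h⟩ * signChange r i * simple ⟨i + 1, h⟩ := by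
  rw [← one_mul (signChange r (i + 1)), ← one_mul (simple _ * signChange r i * _), ← mul_assoc,
    ← mul_assoc]
  refine ext_window fun ⟨k, hk⟩ => ?_
  simp only [window_mul_simple_succ, window_mul_signChange, window_one_mk]
  split_ifs <;> omega

end Windows

section Generators

variable {r : ℕ} {R : Type*} [CommRing R] (q₀ q : R)

lemma T_one : T q₀ q (1 : W r) = 1 := by
  have := RingQuot.mkAlgHom_rel R (HeckeRel.one (r := r) (q₀ := q₀) (q := q))
  rw [map_one] at this
  exact this

lemma T_mul {x y : W r} (h : length (x * y) = length x + length y) :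
    T q₀ q (x * y) = T q₀ q x * T q₀ q y := by
  have := RingQuot.mkAlgHom_rel R (HeckeRel.mul (q₀ := q₀) (q := q) x y h)
  rw [map_mul] at this
  exact this.symm

lemma T_simple_mul_self (i : Fin r) :
    T q₀ q (simple i) * T q₀ q (simple i) =
      (param q₀ q i - 1) • T q₀ q (simple i) + algebraMap R (Hecke r q₀ q) (param q₀ q i) := by
  have := RingQuot.mkAlgHom_rel R (HeckeRel.quad (q₀ := q₀) (q := q) i)
  rw [map_mul, map_add, map_smul, AlgHom.commutes] at this
  exact this

lemma T_mul_simple {w : W r} {i : Fin r} (h : IsAscent w i) :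
    T q₀ q (w * simple i) = T q₀ q w * T q₀ q (simple i) :=
  T_mul q₀ q (by rw [length_mul_simple h, length_simple])

lemma T_simple_mul {w : W r} {i : Fin r} (h : IsAscent w⁻¹ i) :
    T q₀ q (simple i * w) = T q₀ q (simple i) * T q₀ q w :=
  T_mul q₀ q (by rw [length_simple_mul h, length_simple, add_comm])

/-- The generator `T_{s_i}`, and `0` if `r ≤ i`. -/
def gen (r : ℕ) (i : ℕ) : Hecke r q₀ q := if h : i < r then T q₀ q (simple ⟨i, h⟩) else 0

lemma gen_of_lt {i : ℕ} (h : i < r) : gen q₀ q r i = T q₀ q (simple ⟨i, h⟩) := dif_pos h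

/-- Both words are reduced: every letter is an ascent of the word before it, as the windows show. So
`T` of their common value expands in two ways. -/
lemma gen_braid {i : ℕ} (h : i + 2 < r) :
    gen q₀ q r (i + 1) * gen q₀ q r (i + 2) * gen q₀ q r (i + 1) =
      gen q₀ q r (i + 2) * gen q₀ q r (i + 1) * gen q₀ q r (i + 2) := by
  have e := congrArg (T q₀ q) (simple_braid h)
  rw [T_mul_simple, T_mul_simple, T_mul_simple, T_mul_simple, T_mul_simple, T_mul_simple, T_one,
    one_mul, one_mul] at e
  · rw [gen_of_lt q₀ q h, gen_of_lt q₀ q (show i + 1 < r by omega)]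
    exact e
  all_goals
    rw [isAscent_mk_succ]
    simp only [window_mul_simple_succ, window_one_mk]
    (try split_ifs) <;> omega

lemma gen_comm {i j : ℕ} (hij : i + 2 ≤ j) (hj : j + 1 < r) :
    Commute (gen q₀ q r (i + 1)) (gen q₀ q r (j + 1)) := by
  have e := congrArg (T q₀ q) (simple_comm hij hj)
  rw [T_mul_simple, T_mul_simple, T_mul_simple, T_mul_simple, T_one, one_mul, one_mul] at e
  · rw [gen_of_lt q₀ q hj, gen_of_lt q₀ q (show i + 1 < r by omega)]
    exact e
  all_goals
    rw [isAscent_mk_succ]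
    simp only [window_mul_simple_succ, window_one_mk]
    (try split_ifs) <;> omega

lemma gen_zero_comm {j : ℕ} (hij : 1 ≤ j) (hj : j + 1 < r) :
    Commute (gen q₀ q r 0) (gen q₀ q r (j + 1)) := by
  have e := congrArg (T q₀ q) (simple_zero_comm hij hj)
  rw [T_mul_simple, T_mul_simple, T_mul_simple, T_mul_simple, T_one, one_mul, one_mul] at e
  · rw [gen_of_lt q₀ q hj, gen_of_lt q₀ q (show 0 < r by omega)]
    exact e
  all_goals
    first | rw [isAscent_mk_succ] | rw [isAscent_mk_zero]
    simp only [window_mul_simple_succ, window_mul_simple_zero, window_one_mk]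
    (try split_ifs) <;> first | omega | simp_all

lemma gen_braid_zero (h : 1 < r) :
    Commute (gen q₀ q r 0) (gen q₀ q r 1 * gen q₀ q r 0 * gen q₀ q r 1) := by
  have e := congrArg (T q₀ q) (simple_braid_zero h)
  rw [T_mul_simple, T_mul_simple, T_mul_simple, T_mul_simple, T_mul_simple, T_mul_simple,
    T_mul_simple, T_mul_simple, T_one, one_mul, one_mul] at e
  · rw [gen_of_lt q₀ q h, gen_of_lt q₀ q (show 0 < r by omega)]
    rw [commute_iff_eq, ← mul_assoc, ← mul_assoc]
    exact e
  all_goals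
    first | rw [isAscent_mk_succ] | rw [isAscent_mk_zero]
    simp only [window_mul_simple_succ, window_mul_simple_zero, window_one_mk]
    (try split_ifs) <;> first | omega | simp_all

lemma isHecke_gen : IsHecke r (gen q₀ q r) q₀ q where
  quad_zero h := by
    rw [gen_of_lt q₀ q h]
    exact T_simple_mul_self q₀ q _
  quad i h0 h := by
    rw [gen_of_lt q₀ q h, T_simple_mul_self, param, if_neg h0.ne']
  isBraid :=
    { braid := fun i h0 h => by
        obtain ⟨i, rfl⟩ : ∃ k, i = k + 1 := ⟨i - 1, by omega⟩
        exact gen_braid q₀ q h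
      comm := fun i j h0 hij h => by
        obtain ⟨i, rfl⟩ : ∃ k, i = k + 1 := ⟨i - 1, by omega⟩
        obtain ⟨j, rfl⟩ : ∃ k, j = k + 1 := ⟨j - 1, by omega⟩
        exact gen_comm q₀ q (by omega) h
      comm_zero := fun j hj h => by
        obtain ⟨j, rfl⟩ : ∃ k, j = k + 1 := ⟨j - 1, by omega⟩
        exact gen_zero_comm q₀ q (by omega) h
      braid_zero := gen_braid_zero q₀ q }

lemma T_signChange {i : ℕ} (h : i < r) :
    T q₀ q (signChange r i) = jm (gen q₀ q r) (gen q₀ q r 0) i := by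
  induction i with
  | zero => rw [jm_zero, gen_of_lt q₀ q h, simple_of_eq_zero rfl]
  | succ i ih =>
    rw [jm_succ, ← ih (by omega), gen_of_lt q₀ q h, signChange_succ h, T_mul_simple, T_simple_mul]
    -- Left multiplication requires an ascent of the inverse, and sign changes are involutions.
    · rw [inv_eq_of_mul_eq_one_left (signChange_mul_self i), ← one_mul (signChange r i),
        isAscent_mk_succ]
      simp only [window_mul_signChange, window_one_mk]
      (try split_ifs) <;> omega
    · rw [← one_mul (simple _ * signChange r i), ← mul_assoc, isAscent_mk_succ]
      simp only [window_mul_signChange, window_mul_simple_succ, window_one_mk]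
      (try split_ifs) <;> omega

lemma piElt_eq_piProd {a : ℕ} (ha : a ≤ r) : piElt r q₀ q a = piProd (gen q₀ q r) q a := by
  unfold piElt piProd
  congr 1
  refine List.map_congr_left fun i hi => ?_
  rw [T_signChange q₀ q (by have := List.mem_range.1 hi; omega)]

end Generators

/-! ## Young subgroups -/

section Young

variable {r : ℕ}

/-- A generator `s_i` with `i` not a partial sum preserves each initial segment of positions ending
at a partial sum. The case `k = 0` says that no sign is changed. -/
lemma window_le_iff_of_mem_young {c : List ℕ} {w : W r} (hw : w ∈ young r c) (k : ℕ) (j : Fin r) :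
    window w j ≤ ((c.take k).sum : ℕ) ↔ j.val < (c.take k).sum := by
  have key : ∀ (x : W r), (∀ j, window x j ≤ ((c.take k).sum : ℕ) ↔ j.val < (c.take k).sum) →
      ∀ i : Fin r, 0 < i.val → i.val ≠ (c.take k).sum →
      ∀ j, window (x * simple i) j ≤ ((c.take k).sum : ℕ) ↔ j.val < (c.take k).sum := by
    intro x hx i h0 hi j
    rw [window_mul_simple_of_pos x h0, Function.comp_apply, hx, Equiv.swap_apply_def]
    split_ifs with h1 h2
    · rw [h1]
      simp only
      omega
    · rw [h2]
      simp only
      omega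
    · rfl
  revert j
  induction hw using Subgroup.closure_induction_right with
  | one =>
    intro j
    rw [window_one]
    omega
  | mul_right x y hy hx ih =>
    obtain ⟨i, h0, hi, rfl⟩ := hx
    exact key x ih i h0 (hi k)
  | mul_inv_cancel x y hy hx ih =>
    obtain ⟨i, h0, hi, rfl⟩ := hx
    rw [simple_inv]
    exact key x ih i h0 (hi k)

/-- At a partial sum, the entry before it is at most that sum and the entry after it is larger, so
there is no descent. Thus stripping descents never leaves the Young subgroup. -/
lemma of_not_isAscent_of_mem_young {c : List ℕ} {w : W r} (hw : w ∈ young r c) {i : Fin r}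
    (hi : ¬ IsAscent w i) : 0 < i.val ∧ ∀ k, i.val ≠ (c.take k).sum := by
  have h0 : 0 < i.val := by
    rw [Nat.pos_iff_ne_zero]
    intro h
    rw [isAscent_of_eq_zero h] at hi
    have := window_le_iff_of_mem_young hw 0 i
    simp at this
    omega
  refine ⟨h0, fun k hk => hi ?_⟩
  rw [isAscent_of_pos h0]
  have h1 := window_le_iff_of_mem_young hw k i
  have h2 := window_le_iff_of_mem_young hw k (prev i)
  simp only at h2
  omega

variable {R : Type*} [CommRing R] (q₀ q : R)

lemma commute_T_of_mem_young {c : List ℕ} {X : Hecke r q₀ q}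
    (hX : ∀ i : Fin r, 0 < i.val → (∀ k, i.val ≠ (c.take k).sum) → Commute X (T q₀ q (simple i)))
    (w : W r) (hw : w ∈ young r c) : Commute X (T q₀ q w) := by
  induction w using induction_on_ascents with
  | one =>
    rw [T_one]
    exact Commute.one_right X
  | mul_simple w i h ih =>
    obtain ⟨h0, hi⟩ := of_not_isAscent_of_mem_young hw fun h' => (isAscent_mul_simple w i).1 h' h
    have hs : simple i ∈ young r c := Subgroup.subset_closure ⟨i, h0, hi, rfl⟩
    rw [T_mul_simple q₀ q h]
    exact (ih ((Subgroup.mul_mem_cancel_right _ hs).1 hw)).mul_right (hX i h0 hi)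

lemma commute_piElt_xBar {n : ℕ} (lam : Bicomp n r) :
    Commute (piElt r q₀ q lam.size₁) (xBar q₀ q lam) := by
  classical
  have hle : lam.size₁ ≤ r := by
    have := lam.2
    unfold Bicomp.size₁
    omega
  refine Commute.sum_right _ _ _ fun w hw => ?_
  simp only [Finset.mem_filter, Finset.mem_univ, true_and] at hw
  refine commute_T_of_mem_young q₀ q (fun i h0 hi => ?_) w hw
  -- `|λ⁽¹⁾|` is the partial sum over the first `max n r` parts, so the Young subgroup omits the one
  -- generator `s_a` for which commutation with `π_a` is not available.
  have hne : i.val ≠ lam.size₁ := by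
    have := hi (max n r)
    rwa [Bicomp.bar, List.take_left' (List.length_ofFn), List.sum_ofFn] at this
  rw [piElt_eq_piProd q₀ q hle, ← gen_of_lt q₀ q i.isLt]
  rcases Nat.lt_or_gt_of_ne hne with h | h
  · exact ((isHecke_gen q₀ q).commute_piProd_of_lt h0 h hle).symm
  · exact ((isHecke_gen q₀ q).commute_piProd_of_gt h i.isLt).symm

end Young

/-! ## Right ideals generated by `p x`, where `p` is invertible on its own image -/

section RightIdeal

variable {H : Type*} [Ring H]

/-- As `p x = x p`, the ideal `p x H` lies in `x H`. Left multiplication by `p` acts on `p x H` as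
the unit `z`, so it is bijective there, and its inverse followed by the inclusion is a section of `x
H → p x H`. -/
lemma exists_retraction_span_mul {p x z : H} (hpx : Commute p x) (hzp : Commute z p)
    (hz : IsUnit z) (hpp : p * p = z * p) :
    ∃ (f : Submodule.span Hᵐᵒᵖ {x} →ₗ[Hᵐᵒᵖ] Submodule.span Hᵐᵒᵖ {p * x})
      (g : Submodule.span Hᵐᵒᵖ {p * x} →ₗ[Hᵐᵒᵖ] Submodule.span Hᵐᵒᵖ {x}),
      f ∘ₗ g = LinearMap.id := by
  have mem : ∀ {u v : H}, u ∈ Submodule.span Hᵐᵒᵖ {v} ↔ ∃ h, v * h = u := fun {u v} => by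
    rw [Submodule.mem_span_singleton]
    exact ⟨fun ⟨a, ha⟩ => ⟨a.unop, ha⟩, fun ⟨h, hh⟩ => ⟨MulOpposite.op h, hh⟩⟩
  let f : Submodule.span Hᵐᵒᵖ {x} →ₗ[Hᵐᵒᵖ] Submodule.span Hᵐᵒᵖ {p * x} :=
    { toFun := fun y => ⟨p * y.1, by
        obtain ⟨h, hh⟩ := mem.1 y.2
        exact mem.2 ⟨h, by rw [← hh, mul_assoc]⟩⟩
      map_add' := fun _ _ => Subtype.ext (mul_add _ _ _)
      map_smul' := fun a y => Subtype.ext (mul_assoc p y.1 a.unop).symm }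
  have hle : Submodule.span Hᵐᵒᵖ {p * x} ≤ Submodule.span Hᵐᵒᵖ {x} := by
    intro y hy
    obtain ⟨h, rfl⟩ := mem.1 hy
    exact mem.2 ⟨p * h, by rw [← mul_assoc, hpx.eq]⟩
  let i := Submodule.inclusion hle
  have hinj : Function.Injective (f ∘ₗ i) := by
    rw [← LinearMap.ker_eq_bot, LinearMap.ker_eq_bot']
    rintro ⟨y, hy⟩ h0
    obtain ⟨h, rfl⟩ := mem.1 hy
    have h1 : p * (p * x * h) = 0 := congrArg Subtype.val h0
    have h2 : z * (p * x * h) = 0 := by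
      rw [← h1, ← mul_assoc, ← mul_assoc, ← mul_assoc, ← mul_assoc, hpp]
    exact Subtype.ext (hz.mul_right_eq_zero.1 h2)
  have hsurj : Function.Surjective (f ∘ₗ i) := by
    rintro ⟨y, hy⟩
    obtain ⟨h, rfl⟩ := mem.1 hy
    obtain ⟨z', hz'⟩ := hz.exists_right_inv
    refine ⟨⟨p * x * (z' * h), mem.2 ⟨_, rfl⟩⟩, Subtype.ext ?_⟩
    change p * (p * x * (z' * h)) = p * x * h
    calc p * (p * x * (z' * h)) = p * (x * p) * (z' * h) := by
          rw [hpx.eq]; simp only [mul_assoc]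
      _ = (p * x) * p * (z' * h) := by noncomm_ring
      _ = x * (p * p) * (z' * h) := by rw [hpx.eq, mul_assoc x]
      _ = x * p * (z * z') * h := by rw [hpp, hzp.eq]; noncomm_ring
      _ = _ := by rw [hz', mul_one, hpx.eq]
  let e := LinearEquiv.ofBijective (f ∘ₗ i) ⟨hinj, hsurj⟩
  refine ⟨f, i ∘ₗ e.symm.toLinearMap, ?_⟩
  ext1 y
  exact e.apply_symm_apply y

end RightIdeal

/-! ## Partial sums of compositions -/

section PartialSums

/-- The set of partial sums of a list is not changed by removing the zeros. -/
lemma exists_sum_take_filter (c : List ℕ) (m : ℕ) :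
    (∃ k, m = (c.take k).sum) ↔ ∃ k, m = ((c.filter (· ≠ 0)).take k).sum := by
  induction c generalizing m with
  | nil => simp
  | cons a c ih =>
    have hcons : ∀ d : List ℕ, (∃ k, m = ((a :: d).take k).sum) ↔
        m = 0 ∨ ∃ m', m = a + m' ∧ ∃ k, m' = (d.take k).sum := by
      intro d
      constructor
      · rintro ⟨k, rfl⟩
        cases k with
        | zero => exact Or.inl rfl
        | succ k => exact Or.inr ⟨_, by simp, k, rfl⟩
      · rintro (rfl | ⟨_, rfl, k, rfl⟩)
        · exact ⟨0, rfl⟩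
        · exact ⟨k + 1, by simp⟩
    rw [hcons]
    by_cases ha : a = 0
    · subst ha
      simp only [zero_add, exists_eq_left', ih]
      rw [List.filter_cons_of_neg (by simp)]
      refine ⟨fun h => h.elim (fun h => ⟨0, by simp [h]⟩) id, Or.inr⟩
    · rw [List.filter_cons_of_pos (by simpa using ha)]
      simp only [ih]
      constructor
      · rintro (rfl | ⟨_, rfl, k, rfl⟩)
        · exact ⟨0, rfl⟩
        · exact ⟨k + 1, by simp⟩
      · rintro ⟨k, rfl⟩
        cases k with
        | zero => exact Or.inl rfl
        | succ k => exact Or.inr ⟨_, by simp, k, rfl⟩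

lemma young_eq_of_filter_eq (r : ℕ) {c d : List ℕ}
    (h : c.filter (· ≠ 0) = d.filter (· ≠ 0)) : young r c = young r d := by
  have h1 : ∀ m : ℕ, (∀ k, m ≠ (c.take k).sum) ↔ ∀ k, m ≠ (d.take k).sum := by
    intro m
    have h2 := exists_sum_take_filter c m
    rw [h, ← exists_sum_take_filter d m] at h2
    simpa using not_congr h2
  simp only [young, h1]

lemma length_filter_ne_zero_le_sum (c : List ℕ) : (c.filter (· ≠ 0)).length ≤ c.sum := by
  induction c with
  | nil => simp
  | cons a c ih =>
    by_cases ha : a = 0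
    · subst ha
      simpa using ih
    · rw [List.filter_cons_of_pos (by simpa using ha), List.length_cons, List.sum_cons]
      omega

lemma sum_filter_ne_zero (c : List ℕ) : (c.filter (· ≠ 0)).sum = c.sum := by
  induction c with
  | nil => simp
  | cons a c ih =>
    by_cases ha : a = 0
    · subst ha
      simpa using ih
    · rw [List.filter_cons_of_pos (by simpa using ha), List.sum_cons, List.sum_cons, ih]

lemma exists_ofFn_eq {n : ℕ} (L : List ℕ) (h : L.length = n) : ∃ g : Fin n → ℕ, List.ofFn g = L := by
  subst h
  exact ⟨L.get, List.ofFn_get L⟩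

lemma Bicomp.sum_bar {n r : ℕ} (lam : Bicomp n r) : lam.bar.sum = r := by
  rw [bar, List.sum_append, List.sum_ofFn, List.sum_ofFn, lam.2]

lemma exists_bicompOne_young_eq {n r : ℕ} (hn : r ≤ n) (lam : Bicomp n r) :
    ∃ mu : BicompOne n r, young r mu.1.bar = young r lam.bar := by
  set L := lam.bar.filter (· ≠ 0) with hL
  have hlen : L.length ≤ r := (length_filter_ne_zero_le_sum _).trans_eq lam.sum_bar
  -- At most `r ≤ n` parts are nonzero, so they all fit into the second composition.
  obtain ⟨g, hg⟩ := exists_ofFn_eq (n := n) (L ++ List.replicate (n - L.length) 0) (by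
    rw [List.length_append, List.length_replicate]; omega)
  have hsum : ∑ i, g i = r := by
    rw [← List.sum_ofFn, hg, List.sum_append, sum_filter_ne_zero, lam.sum_bar]
    simp
  refine ⟨⟨⟨(fun _ => 0, g), by simpa using hsum⟩, by simp [Bicomp.size₁]⟩,
    young_eq_of_filter_eq r ?_⟩
  simp only [Bicomp.bar, List.ofFn_const, hg, List.filter_append]
  rw [hL, List.filter_filter]
  simp [Bicomp.bar]

end PartialSums

/-! ## The Morita equivalence -/

section Main

variable {n r : ℕ} {R : Type*} [CommRing R] (q₀ q : R)

lemma x_of_size_eq_zero {mu : Bicomp n r} (h : mu.size₁ = 0) : x q₀ q mu = xBar q₀ q mu := by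
  rw [x, h]
  simp [piElt]

lemma exists_retraction_permModule (hn : r ≤ n)
    (hu : ∀ i < r, ∀ k ≤ 2 * i, IsUnit (q ^ i + q₀ * q ^ k)) (lam : Bicomp n r) :
    ∃ (mu : BicompOne n r)
      (f : PermModule q₀ q mu.1 →ₗ[(Hecke r q₀ q)ᵐᵒᵖ] PermModule q₀ q lam)
      (g : PermModule q₀ q lam →ₗ[(Hecke r q₀ q)ᵐᵒᵖ] PermModule q₀ q mu.1),
      f ∘ₗ g = LinearMap.id := by
  obtain ⟨mu, hmu⟩ := exists_bicompOne_young_eq hn lam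
  refine ⟨mu, ?_⟩
  have hx : x q₀ q mu.1 = xBar q₀ q lam := by
    rw [x_of_size_eq_zero q₀ q mu.2, xBar, xBar, hmu]
  have hle : lam.size₁ ≤ r := by
    have := lam.2
    unfold Bicomp.size₁
    omega
  have hH := isHecke_gen (r := r) q₀ q
  have key := exists_retraction_span_mul (commute_piElt_xBar q₀ q lam)
    (z := zProd (gen q₀ q r) q₀ q lam.size₁)
    (by rw [piElt_eq_piProd q₀ q hle]; exact hH.commute_zProd_piProd hle le_rfl)
    (hH.isUnit_zProd hu hle)
    (by rw [piElt_eq_piProd q₀ q hle]; exact hH.piProd_mul_self hle)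
  have hx' : x q₀ q lam = piElt r q₀ q lam.size₁ * x q₀ q mu.1 := by rw [hx, x]
  rw [← hx, ← hx'] at key
  exact key

instance : Finite (Bicomp n r) := by
  refine Finite.of_injective
    (β := (Fin (max n r) → Fin (r + 1)) × (Fin n → Fin (r + 1)))
    (fun lam => (fun i => ⟨lam.1.1 i, ?_⟩, fun i => ⟨lam.1.2 i, ?_⟩)) ?_
  · have h1 := lam.2
    have h2 := Finset.single_le_sum (f := lam.1.1) (fun _ _ => Nat.zero_le _) (Finset.mem_univ i)
    omega
  · have h1 := lam.2
    have h2 := Finset.single_le_sum (f := lam.1.2) (fun _ _ => Nat.zero_le _) (Finset.mem_univ i)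
    omega
  · intro a b h
    simp only [Prod.mk.injEq, funext_iff, Fin.mk.injEq] at h
    exact Subtype.ext (Prod.ext (funext h.1) (funext h.2))

-- The identity of the large sum is the sum of the projections to its summands, and the one for `λ`
-- factors through the summand `μ(λ)` of the small sum.
open DirectSum in
theorem isMoritaEquivalent_qSchur (hn : r ≤ n)
    (hu : ∀ i < r, ∀ k ≤ 2 * i, IsUnit (q ^ i + q₀ * q ^ k)) :
    IsMoritaEquivalent R (qSchurTwo n r q₀ q) (qSchurOne n r q₀ q) := by
  classical
  have := Fintype.ofFinite (Bicomp n r)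
  choose mu f g hfg using exists_retraction_permModule (n := n) q₀ q hn hu
  let inc : (⨁ lam : BicompOne n r, PermModule q₀ q lam.1) →ₗ[(Hecke r q₀ q)ᵐᵒᵖ]
      (⨁ lam : Bicomp n r, PermModule q₀ q lam) :=
    toModule (Hecke r q₀ q)ᵐᵒᵖ _ _ fun lam => lof (Hecke r q₀ q)ᵐᵒᵖ _ (fun lam : Bicomp n r => PermModule q₀ q lam) lam.1
  let pr : (⨁ lam : Bicomp n r, PermModule q₀ q lam) →ₗ[(Hecke r q₀ q)ᵐᵒᵖ]
      (⨁ lam : BicompOne n r, PermModule q₀ q lam.1) :=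
    toModule (Hecke r q₀ q)ᵐᵒᵖ _ _ fun lam => if h : lam.size₁ = 0 then
      lof (Hecke r q₀ q)ᵐᵒᵖ _ (fun lam : BicompOne n r => PermModule q₀ q lam.1) ⟨lam, h⟩ else 0
  refine isMoritaEquivalent_end_of_retract inc pr ?_
    (fun lam => lof (Hecke r q₀ q)ᵐᵒᵖ _ (fun lam : Bicomp n r => PermModule q₀ q lam) lam ∘ₗ f lam ∘ₗ
      component (Hecke r q₀ q)ᵐᵒᵖ _ (fun lam : BicompOne n r => PermModule q₀ q lam.1) (mu lam))
    (fun lam => lof (Hecke r q₀ q)ᵐᵒᵖ _ (fun lam : BicompOne n r => PermModule q₀ q lam.1) (mu lam) ∘ₗ g lam ∘ₗ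
      component (Hecke r q₀ q)ᵐᵒᵖ _ (fun lam : Bicomp n r => PermModule q₀ q lam) lam) ?_
  · refine DirectSum.linearMap_ext _ fun lam => LinearMap.ext fun y => ?_
    simp only [inc, pr, LinearMap.comp_apply, toModule_lof, dif_pos lam.2, LinearMap.id_apply]
  · refine DirectSum.linearMap_ext _ fun lam => LinearMap.ext fun y => ?_
    simp only [LinearMap.comp_apply, LinearMap.sum_apply, LinearMap.id_apply, component.lof_self]
    rw [Finset.sum_eq_single lam]
    · rw [component.lof_self]
      exact congrArg _ (LinearMap.congr_fun (hfg lam) y)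
    · intro lam' _ hne
      rw [component.of, dif_neg (Ne.symm hne), map_zero, map_zero, map_zero]
    · intro h
      exact absurd (Finset.mem_univ _) h

end Main

/-! ## Invertibility of the parameters -/

section Units

/-- Write `q^i + q₀ q^k = q^k (q₀ + q^(i-k))`; as `|i - k| ≤ r - 1`, the second factor divides
`g_r`. -/
lemma isUnit_of_algebra (r : ℕ) (R : Type*) [CommRing R] [Algebra (Z₀g r) R] :
    ∀ i < r, ∀ k ≤ 2 * i, IsUnit (qIn r R ^ i + q₀In r R * qIn r R ^ k) := by
  intro i hi k hk
  let φ : Z₀ →+* R := (algebraMap (Z₀g r) R).comp (algebraMap Z₀ (Z₀g r))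
  have hg : IsUnit (φ (g r)) :=
    (IsLocalization.Away.algebraMap_isUnit (S := Z₀g r) (g r)).map (algebraMap (Z₀g r) R)
  have hpow : ∀ m : ℕ, qIn r R ^ m = φ (Z₀.qPow m) := by
    intro m
    have : Z₀.qPow m = Z₀.qPow 1 ^ m := by
      simp [Z₀.qPow, ← map_pow, LaurentPolynomial.T_pow]
    rw [this, map_pow]
    rfl
  have hmul : ∀ a b : ℤ, Z₀.qPow (a + b) = Z₀.qPow a * Z₀.qPow b := by
    intro a b
    simp only [Z₀.qPow, LaurentPolynomial.T_add, map_mul]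
  have hunit : IsUnit (φ (Z₀.qPow k)) := by
    refine IsUnit.map φ ((isUnit_iff_exists_inv).2 ⟨Z₀.qPow (-k), ?_⟩)
    rw [← hmul]
    simp [Z₀.qPow]
  have hfac : IsUnit (φ (Z₀.q₀ + Z₀.qPow ((i : ℤ) - k))) := by
    rw [g, map_prod, IsUnit.prod_iff] at hg
    exact hg _ (Finset.mem_Icc.2 ⟨by omega, by omega⟩)
  have : qIn r R ^ i + q₀In r R * qIn r R ^ k =
      φ (Z₀.qPow k) * φ (Z₀.q₀ + Z₀.qPow ((i : ℤ) - k)) := by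
    rw [← map_mul, mul_add, ← hmul, add_sub_cancel, map_add, map_mul, hpow, hpow, add_comm,
      mul_comm]
    rfl
  rw [this]
  exact hunit.mul hfac

/-- Factor out the smaller power of `Q`. Linearity is asked only for the exponent `|c - d|`, so that
the unitary case needs odd powers alone. -/
lemma isUnit_pow_add_pow {R : Type*} [CommRing R] {ℓ Q : ℕ} (hℓ : ℓ.Prime) (hℓQ : ¬ ℓ ∣ Q)
    (hR : ∀ k : ℕ, k.Coprime ℓ → IsUnit (k : R)) {c d : ℕ}
    (hlin : ∀ e, (c = d + e ∨ d = c + e) → ¬ ℓ ∣ Q ^ e + 1) :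
    IsUnit ((Q : R) ^ c + (Q : R) ^ d) := by
  wlog hcd : c ≤ d generalizing c d
  · rw [add_comm]
    exact this (fun e he => hlin e he.symm) (le_of_not_ge hcd)
  obtain ⟨e, rfl⟩ := Nat.exists_eq_add_of_le hcd
  have h := hR (Q ^ c * (Q ^ e + 1)) (Nat.Coprime.symm ((Nat.Prime.coprime_iff_not_dvd hℓ).2 ?_))
  · convert h using 1
    push_cast
    ring
  · intro h
    rcases hℓ.dvd_mul.1 h with h | h
    · exact hℓQ (hℓ.dvd_of_dvd_pow h)
    · exact hlin e (Or.inr rfl) h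

lemma IsLinearPrimeCase.isUnit {R : Type*} [CommRing R] {ℓ a b : ℕ}
    (h : IsLinearPrimeCase ℓ a b) (hR : ∀ k : ℕ, k.Coprime ℓ → IsUnit (k : R)) (i k : ℕ) :
    IsUnit ((b : R) ^ i + (a : R) * (b : R) ^ k) := by
  cases h with
  | symplecticOrthogonal Q m hQ hℓ hℓQ hlin =>
    have := isUnit_pow_add_pow (c := i) (d := m + k) hℓ hℓQ hR fun e _ => hlin e
    rw [pow_add] at this
    push_cast
    exact this
  | unitary Q m hQ hℓ hℓQ hlin =>
    -- An even and an odd exponent of `Q`, so their difference is odd.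
    have := isUnit_pow_add_pow (c := 2 * i) (d := 2 * m + 1 + 2 * k) hℓ hℓQ hR fun e he => by
      obtain ⟨e', rfl⟩ : ∃ e', e = 2 * e' + 1 := ⟨e / 2, by omega⟩
      exact hlin e'
    rw [pow_add, pow_mul _ 2 i, pow_mul _ 2 k] at this
    push_cast
    exact this

end Units

end QSchurB

end

/-- The second part is the linear prime case: there the base ring `Z'` is any commutative ring in
which the integers prime to `ℓ` are invertible, such as each of the rings `K`, `O`, `k` of an
`ℓ`-modular system. -/
theorem theorem3p4 (r : ℕ) (hr : 0 < r) (Z' : Type*) [CommRing Z'] :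
    (∀ [Algebra (QSchurB.Z₀g r) Z'],
      IsMoritaEquivalent Z'
        (QSchurB.qSchurTwo r r (QSchurB.q₀In r Z') (QSchurB.qIn r Z'))
        (QSchurB.qSchurOne r r (QSchurB.q₀In r Z') (QSchurB.qIn r Z'))) ∧
    (∀ ℓ a b : ℕ, QSchurB.IsLinearPrimeCase ℓ a b →
      (∀ k : ℕ, k.Coprime ℓ → IsUnit (k : Z')) →
      IsMoritaEquivalent Z'
        (QSchurB.qSchurTwo r r (a : Z') (b : Z'))
        (QSchurB.qSchurOne r r (a : Z') (b : Z'))) :=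
  ⟨QSchurB.isMoritaEquivalent_qSchur _ _ le_rfl (QSchurB.isUnit_of_algebra r Z'),
    fun _ _ _ h hR => QSchurB.isMoritaEquivalent_qSchur _ _ le_rfl fun i _ k _ => h.isUnit hR i k⟩
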